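/- Let $n \ge 2$ and let $nK_\omega$ be the graph that is the disjoint union of $n$ copies $L_1, \dots, L_n$ of the countably infinite complete graph $K_\omega$. Automorphisms act on the right. Equip $\operatorname{Aut}(nK_\omega)$ with the topology whose basis consists of the sets $[q] = \{g \in \operatorname{Aut}(nK_\omega) : (x)g = (x)q \text{ for all } x \in \operatorname{dom}(q)\}$, where $q$ is an isomorphism between finite induced subgraphs of $nK_\omega$. For $X \subseteq \operatorname{Aut}(nK_\omega)$ let $X^{<\omega}$ be the set of all isomorphisms between finite induced subgraphs of $nK_\omega$ that have an extension in $X$. Every $f \in \operatorname{Aut}(nK_\omega)$ induces a permutation $\overline f \in S_n$ by $(i)\overline f = j$ if $(L_i)f = L_j$. For $f \in \operatorname{Aut}(nK_\omega)$ and a finite set $\Sigma$ of vertices of $nK_\omega$ define $$D_f = \{g \in \operatorname{Aut}(nK_\omega) : \langle f, g\rangle \text{ is dense in } \operatorname{Aut}(nK_\omega)\},$$ $$\mathcal A_f = \{g \in \operatorname{Aut}(nK_\omega) : \langle \overline f, \overline g\rangle = S_n\},$$ $$\mathcal A_{f,\Sigma} = \{g \in \mathcal A_f : \Sigma \text{ contains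 exactly one vertex of every orbit of } g\}.$$ Call $f$ non-stabilizing if for every proper subset $\Gamma$ of the vertex set of $nK_\omega$, every $x \in \Gamma$ and every $q \in \mathcal A_f^{<\omega}$ there is $g \in [q] \cap \mathcal A_f$ such that $(x)h \notin \Gamma$ for some $h \in \langle f, g\rangle$. A subset $Y$ of a subspace $X$ of $\operatorname{Aut}(nK_\omega)$ is comeagre in $X$ if it contains a countable intersection of dense relatively open subsets of $X$. Theorem. Let $f \in \operatorname{Aut}(nK_\omega)$. Then $f$ is non-stabilizing if and only if $D_f \subseteq \mathcal A_f$ and $D_f$ is comeagre in $\mathcal A_f$. Furthermore, if $f$ is non-stabilizing and $\Sigma$ is any finite set of vertices of $nK_\omega$, then $D_f \cap \mathcal A_{f,\Sigma}$ is comeagre in $\mathcal A_{f,\Sigma}$. -/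

import Mathlib

namespace GraphAut

section General

variable {V : Type*} (G : SimpleGraph V)

/-- The group of automorphisms of a graph. (In Mathlib's convention `(f * g) x = f (g x)`;
the side on which automorphisms act is irrelevant for the subgroups they generate.) -/
abbrev Aut : Type _ := G ≃g G

/-- An isomorphism between finite induced subgraphs of `G`. -/
structure PartialIso where
  /-- the set of vertices of the first subgraph -/
  dom : Finset V
  /-- the set of vertices of the second subgraph -/
  ran : Finset V
  /-- the isomorphism -/
  toIso : G.induce (dom : Set V) ≃g G.induce (ran : Set V)

variable {G}

/-- `[φ]`, the set of all automorphisms of `G` that extend `φ`. -/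
def PartialIso.extensions (φ : PartialIso G) : Set (Aut G) :=
  {f | ∀ x : (φ.dom : Set V), f x = φ.toIso x}

/-- The topology on `Aut G` with the sets `[φ]` as its basis. -/
instance : TopologicalSpace (Aut G) :=
  TopologicalSpace.generateFrom (Set.range PartialIso.extensions)

/-- `X^{<ω}`, the set of isomorphisms between finite induced subgraphs of `G` that have an
extension in `X`. -/
def finiteRestrictions (X : Set (Aut G)) : Set (PartialIso G) :=
  {φ | (φ.extensions ∩ X).Nonempty}

/-- `D_f`, the set of all `g` such that `⟨f, g⟩` is dense in `Aut G`. -/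
def denseMates (f : Aut G) : Set (Aut G) :=
  {g | Dense (Subgroup.closure {f, g} : Set (Aut G))}

/-- `S` contains exactly one vertex of every orbit of `g`. -/
def IsOrbitReps (S : Set V) (g : Aut G) : Prop :=
  ∀ x : V, ∃! s : V, s ∈ S ∧ ∃ k : ℤ, (g ^ k) x = s

end General

/-- `Y` is a comeagre subset of the subspace `X`: it is contained in `X` and contains a countable
intersection of dense, relatively open subsets of `X`. -/
def IsComeagreIn {T : Type*} [TopologicalSpace T] (Y X : Set T) : Prop :=
  Y ⊆ X ∧ (Subtype.val ⁻¹' Y : Set X) ∈ residual X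

/-- The graph `n K_ω`, the disjoint union of `n` copies of the countably infinite complete graph.
Its connected components are the sets `L_i = {i} × ℕ` for `i : Fin n`. -/
def nKomega (n : ℕ) : SimpleGraph (Fin n × ℕ) where
  Adj x y := x.1 = y.1 ∧ x.2 ≠ y.2
  symm := ⟨fun _ _ h => ⟨h.1.symm, h.2.symm⟩⟩
  loopless := ⟨fun _ h => h.2 rfl⟩

variable {n : ℕ}

theorem fst_apply_eq (f : Aut (nKomega n)) {x y : Fin n × ℕ} (h : x.1 = y.1) :
    (f x).1 = (f y).1 := by
  by_cases h2 : x.2 = y.2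
  · rw [Prod.ext h h2]
  · have hxy : (nKomega n).Adj x y := ⟨h, h2⟩
    exact (f.map_adj_iff.2 hxy).1

/-- The permutation `f̄` of the indices of the connected components that is induced by `f`:
`f̄ i = j` if `f` maps `L_i` onto `L_j` (see `image_component`). -/
def inducedPerm (f : Aut (nKomega n)) : Equiv.Perm (Fin n) where
  toFun i := (f (i, 0)).1
  invFun i := (f.symm (i, 0)).1
  left_inv i := by
    have h := fst_apply_eq f.symm (x := ((f (i, 0)).1, 0)) (y := f (i, 0)) rfl
    simpa using h
  right_inv i := by
    have h := fst_apply_eq f (x := ((f.symm (i, 0)).1, 0)) (y := f.symm (i, 0)) rfl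
    simpa using h

theorem inducedPerm_fst (f : Aut (nKomega n)) (x : Fin n × ℕ) :
    inducedPerm f x.1 = (f x).1 :=
  fst_apply_eq f rfl

theorem image_component (f : Aut (nKomega n)) (i : Fin n) :
    f '' {x | x.1 = i} = {x | x.1 = inducedPerm f i} := by
  ext y
  constructor
  · rintro ⟨x, rfl, rfl⟩
    exact (inducedPerm_fst f x).symm
  · intro hy
    refine ⟨f.symm y, ?_, f.apply_symm_apply y⟩
    apply (inducedPerm f).injective
    rw [inducedPerm_fst, f.apply_symm_apply]
    exact hy

/-- `𝓐_f`, the set of all `g` such that `f̄` and `ḡ` generate the symmetric group `S_n`. -/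
def genMates (f : Aut (nKomega n)) : Set (Aut (nKomega n)) :=
  {g | Subgroup.closure {inducedPerm f, inducedPerm g} = ⊤}

/-- `𝓐_{f,Σ}`, the set of all `g ∈ 𝓐_f` for which `Σ` is a set of orbit representatives. -/
def genMatesWithReps (f : Aut (nKomega n)) (S : Set (Fin n × ℕ)) : Set (Aut (nKomega n)) :=
  {g | g ∈ genMates f ∧ IsOrbitReps S g}

/-- `f` is non-stabilizing: for every proper subset `Γ` of the vertices, every `x ∈ Γ` and every
`q ∈ 𝓐_f^{<ω}` some `g ∈ [q] ∩ 𝓐_f` is such that an element of `⟨f, g⟩` moves `x` out of `Γ`. -/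
def NonStabilizing (f : Aut (nKomega n)) : Prop :=
  ∀ Γ : Set (Fin n × ℕ), Γ ⊂ Set.univ → ∀ x ∈ Γ, ∀ q ∈ finiteRestrictions (genMates f),
    ∃ g ∈ q.extensions ∩ genMates f, ∃ h ∈ Subgroup.closure {f, g}, h x ∉ Γ

end GraphAut

/-! For the forward direction, `denseMates_mem_residual` reduces comeagreness to one extension
problem, solved in `NonStabilizing.exists_realization`: given `g` in the space, finite sets `F`, `E`
and an automorphism `u`, alter `g` without changing it on `F` so that some element of the group
generated by `f` and the new `g` agrees with `u` on `E`. `Flexible` isolates what this needs from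
the space, so that one argument serves both with and without orbit representatives.

Only finitely many values of `g` are ever prescribed, and the others may be chosen fresh. A word `f
* g ^ N` with `N` large then carries a tuple to fresh vertices, except for points on a cycle that is
already fully prescribed. Non-stabilization means that `f` and `g` preserve no nonempty finite set,
which leads tuples out of these cycles (`exists_leads_notMem_stuck`); it also yields a component
`i₀` in which `f` moves infinitely many vertices. As the induced permutations generate the symmetric
group, a tuple can be steered to any arrangement of components (`exists_leads_perm`), and passing
each point through `i₀` makes it the end of a chain of its own (`exists_leads_isPrivate`).

This is done for `u '' E` with the inverse of `g` and for `E` with `g`. The ends of the two journeys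
are then joined by one further application of the new `g` (`exists_link`): out along one, across,
and back along the other. Joining could merge orbits, so it is performed by conjugation, which
preserves orbit representatives.

Conversely, by Baire category a comeagre `D_f` meets every nonempty basic open set of `𝓐_f`, and a
dense subgroup moves any vertex to any other. -/

open Topology

namespace GraphAut

/-! ### Topology of the automorphism group and the comeagreness criterion -/

section Topology

variable {V : Type*} {G : SimpleGraph V}

/-- The restriction of an automorphism to a finite set of vertices. -/
def PartialIso.restrict [DecidableEq V] (g : Aut G) (F : Finset V) : PartialIso G where
  dom := F
  ran := F.image g
  toIso :=
    { toFun := fun x => ⟨g x, by simp⟩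
      invFun := fun y => ⟨g.symm y, by
        obtain ⟨x, hx, hxy⟩ := Finset.mem_image.1 (Finset.mem_coe.1 y.2)
        rw [← hxy, g.symm_apply_apply]
        exact hx⟩
      left_inv := fun x => by simp
      right_inv := fun y => by simp
      map_rel_iff' := by
        intro a b
        exact g.map_adj_iff }

theorem PartialIso.mem_extensions_restrict [DecidableEq V] {g h : Aut G} {F : Finset V} :
    h ∈ (PartialIso.restrict g F).extensions ↔ ∀ x ∈ F, h x = g x :=
  ⟨fun H x hx => H ⟨x, hx⟩, fun H x => H x x.2⟩

theorem isOpen_iff_agree {U : Set (Aut G)} :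
    IsOpen U ↔ ∀ g ∈ U, ∃ F : Finset V, ∀ h : Aut G, (∀ x ∈ F, h x = g x) → h ∈ U := by
  classical
  constructor
  · intro hU
    induction hU with
    | basic s hs =>
      obtain ⟨q, rfl⟩ := hs
      intro g hg
      refine ⟨q.dom, fun h hh x => ?_⟩
      rw [hh x x.2]
      exact hg x
    | univ => exact fun _ _ => ⟨∅, fun _ _ => trivial⟩
    | inter s t _ _ ihs iht =>
      intro g hg
      obtain ⟨F, hF⟩ := ihs g hg.1
      obtain ⟨F', hF'⟩ := iht g hg.2
      exact ⟨F ∪ F', fun h hh => ⟨hF h fun x hx => hh x (Finset.mem_union_left _ hx),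
        hF' h fun x hx => hh x (Finset.mem_union_right _ hx)⟩⟩
    | sUnion S _ ih =>
      rintro g ⟨s, hs, hg⟩
      obtain ⟨F, hF⟩ := ih s hs g hg
      exact ⟨F, fun h hh => ⟨s, hs, hF h hh⟩⟩
  · intro H
    rw [isOpen_iff_forall_mem_open]
    intro g hg
    obtain ⟨F, hF⟩ := H g hg
    refine ⟨(PartialIso.restrict g F).extensions, fun h hh => hF h
      (PartialIso.mem_extensions_restrict.1 hh), TopologicalSpace.isOpen_generateFrom_of_mem ⟨_, rfl⟩,
      PartialIso.mem_extensions_restrict.2 fun _ _ => rfl⟩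

theorem isOpen_agree (g : Aut G) (F : Finset V) : IsOpen {h : Aut G | ∀ x ∈ F, h x = g x} :=
  isOpen_iff_agree.2 fun _ hh => ⟨F, fun _ hk x hx => (hk x hx).trans (hh x hx)⟩

theorem dense_iff_agree {Y : Set (Aut G)} :
    Dense Y ↔ ∀ (g : Aut G) (F : Finset V), ∃ h ∈ Y, ∀ x ∈ F, h x = g x := by
  constructor
  · intro hY g F
    obtain ⟨h, hh, hY⟩ := hY.inter_open_nonempty _ (isOpen_agree g F) ⟨g, fun _ _ => rfl⟩
    exact ⟨h, hY, hh⟩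
  · intro H
    rw [dense_iff_inter_open]
    rintro U hU ⟨g, hg⟩
    obtain ⟨F, hF⟩ := isOpen_iff_agree.1 hU g hg
    obtain ⟨h, hY, hh⟩ := H g F
    exact ⟨h, hF h hh, hY⟩

/-- Membership in the group generated by two automorphisms is, on finite sets, locally constant
in the second generator. -/
theorem exists_agree_closure (f g : Aut G) {h : Aut G} (hh : h ∈ Subgroup.closure {f, g}) (E : Finset V) :
    ∃ F : Finset V, ∀ g' : Aut G, (∀ x ∈ F, g' x = g x) →
      ∃ h' ∈ Subgroup.closure {f, g'}, ∀ x ∈ E, h' x = h x := by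
  classical
  induction hh using Subgroup.closure_induction generalizing E with
  | mem k hk =>
    rcases hk with rfl | rfl
    · exact ⟨∅, fun g' _ => ⟨k, Subgroup.subset_closure (by simp), fun _ _ => rfl⟩⟩
    · exact ⟨E, fun g' hg' => ⟨g', Subgroup.subset_closure (by simp), hg'⟩⟩
  | one => exact ⟨∅, fun g' _ => ⟨1, one_mem _, fun _ _ => rfl⟩⟩
  | mul k l _ _ ihk ihl =>
    obtain ⟨F, hF⟩ := ihl E
    obtain ⟨F', hF'⟩ := ihk (E.image l)
    refine ⟨F ∪ F', fun g' hg' => ?_⟩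
    obtain ⟨l', hl', hl⟩ := hF g' fun x hx => hg' x (Finset.mem_union_left _ hx)
    obtain ⟨k', hk', hk⟩ := hF' g' fun x hx => hg' x (Finset.mem_union_right _ hx)
    refine ⟨k' * l', mul_mem hk' hl', fun x hx => ?_⟩
    rw [RelIso.mul_apply, RelIso.mul_apply, hl x hx, hk _ (Finset.mem_image_of_mem _ hx)]
  | inv k _ ih =>
    obtain ⟨F, hF⟩ := ih (E.image (k⁻¹ : Aut G))
    refine ⟨F, fun g' hg' => ?_⟩
    obtain ⟨k', hk', hk⟩ := hF g' hg'
    refine ⟨k'⁻¹, inv_mem hk', fun x hx => ?_⟩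
    have := hk _ (Finset.mem_image_of_mem _ hx)
    rw [RelIso.apply_inv_self] at this
    conv_lhs => rw [← this]
    rw [RelIso.inv_apply_self]

theorem isOpen_closure_realizes (f : Aut G) (l : List (V × V)) :
    IsOpen {g : Aut G | ∃ h ∈ Subgroup.closure {f, g}, ∀ p ∈ l, h p.1 = p.2} := by
  classical
  rw [isOpen_iff_agree]
  rintro g ⟨h, hh, hl⟩
  obtain ⟨F, hF⟩ := exists_agree_closure f g hh (l.map Prod.fst).toFinset
  refine ⟨F, fun g' hg' => ?_⟩
  obtain ⟨h', hh', H⟩ := hF g' hg'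
  refine ⟨h', hh', fun p hp => ?_⟩
  rw [H p.1 (by simp only [List.mem_toFinset, List.mem_map]; exact ⟨p, hp, rfl⟩), hl p hp]

/-- A criterion for `D_f` to be comeagre in a set of automorphisms. -/
theorem denseMates_mem_residual [Countable V] (f : Aut G) (X : Set (Aut G))
    (H : ∀ g ∈ X, ∀ (u : Aut G) (F E : Finset V), ∃ g' ∈ X, (∀ x ∈ F, g' x = g x) ∧
      ∃ h ∈ Subgroup.closure {f, g'}, ∀ x ∈ E, h x = u x) :
    (Subtype.val ⁻¹' denseMates f : Set X) ∈ residual X := by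
  classical
  -- A finite prescription is a list of pairs. There are countably many lists, and one that no
  -- automorphism satisfies imposes no condition.
  have key : ∀ l : List (V × V), {g : X | (∃ u : Aut G, ∀ p ∈ l, u p.1 = p.2) →
      ∃ h ∈ Subgroup.closure {f, g.1}, ∀ p ∈ l, h p.1 = p.2} ∈ residual X := by
    intro l
    by_cases hu : ∃ u : Aut G, ∀ p ∈ l, u p.1 = p.2
    · obtain ⟨u, hu'⟩ := id hu
      simp only [hu, true_imp_iff]
      refine residual_of_dense_open ((isOpen_closure_realizes f l).preimage continuous_subtype_val) ?_
      rw [dense_iff_inter_open]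
      rintro _ ⟨U, hU, rfl⟩ ⟨g, hg⟩
      obtain ⟨F, hF⟩ := isOpen_iff_agree.1 hU g.1 hg
      obtain ⟨g', hX, hg', h, hh, hE⟩ := H g.1 g.2 u F (l.map Prod.fst).toFinset
      refine ⟨⟨g', hX⟩, hF g' hg', h, hh, fun p hp => ?_⟩
      rw [hE p.1 (by simp only [List.mem_toFinset, List.mem_map]; exact ⟨p, hp, rfl⟩), hu' p hp]
    · exact Filter.univ_mem' fun _ h => absurd h hu
  refine Filter.mem_of_superset (countable_iInter_mem.2 key) fun g hg => ?_
  rw [Set.mem_iInter] at hg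
  rw [Set.mem_preimage, denseMates, Set.mem_ofPred_eq, dense_iff_agree]
  intro u E
  obtain ⟨h, hh, hl⟩ := hg (E.toList.map fun x => (x, u x)) ⟨u, by simp⟩
  refine ⟨h, hh, fun x hx => hl (x, u x) ?_⟩
  simpa using hx

/-- The graph of an automorphism and of its inverse, as a pair of functions. -/
def pairOfFuns (g : Aut G) : (V → V) × (V → V) := (g, g.symm)

/-- The group is Polish: recording the inverse along with `g` embeds it as a closed set in a product
of countable discrete spaces. The image of `g` alone need not be closed, since a limit of bijections
may fail to be onto. -/
theorem baireSpace_aut [Countable V] : BaireSpace (Aut G) := by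
  classical
  let _ : TopologicalSpace V := ⊥
  have : DiscreteTopology V := ⟨rfl⟩
  have hc : ∀ x, Continuous fun p : (V → V) × (V → V) => p.1 x := fun x =>
    (continuous_apply x).comp continuous_fst
  have hc' : ∀ x, Continuous fun p : (V → V) × (V → V) => p.2 x := fun x =>
    (continuous_apply x).comp continuous_snd
  have hcont : Continuous (pairOfFuns : Aut G → _) := by
    refine Continuous.prodMk (continuous_pi fun x => ?_) (continuous_pi fun x => ?_)
    · refine continuous_def.2 fun s _ => isOpen_iff_agree.2 fun g hg => ⟨{x}, fun h hh => ?_⟩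
      rw [Set.mem_preimage, hh x (by simp)]
      exact hg
    · refine continuous_def.2 fun s _ => isOpen_iff_agree.2 fun g hg => ⟨{g.symm x}, fun h hh => ?_⟩
      have h1 := hh _ (Finset.mem_singleton_self _)
      rw [g.apply_symm_apply] at h1
      rw [Set.mem_preimage, ← h1, h.symm_apply_apply]
      exact hg
  have hind : IsInducing (pairOfFuns : Aut G → _) := by
    refine ⟨le_antisymm hcont.le_induced ?_⟩
    intro U hU
    choose! F hF using isOpen_iff_agree.1 hU
    refine ⟨⋃ g ∈ U, ⋂ x ∈ F g, (fun p : (V → V) × (V → V) => p.1 x) ⁻¹' {g x},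
      isOpen_biUnion fun g _ => isOpen_biInter_finset fun x _ =>
        (isOpen_discrete _).preimage (hc x), Set.ext fun h => ⟨fun hh => ?_, fun hh => ?_⟩⟩
    · obtain ⟨g, hg, hh⟩ := Set.mem_iUnion₂.1 hh
      exact hF g hg h fun x hx => Set.mem_iInter₂.1 hh x hx
    · exact Set.mem_iUnion₂.2 ⟨h, hh, Set.mem_iInter₂.2 fun x _ => rfl⟩
  have hinj : Function.Injective (pairOfFuns : Aut G → _) := fun g h hgh =>
    RelIso.ext fun x => congrFun (congrArg Prod.fst hgh) x
  have hrange : Set.range (pairOfFuns : Aut G → _) =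
      (⋂ x, {p | p.2 (p.1 x) = x}) ∩ (⋂ x, {p | p.1 (p.2 x) = x}) ∩
        ⋂ x, ⋂ y, {p | G.Adj (p.1 x) (p.1 y) ↔ G.Adj x y} := by
    ext p
    constructor
    · rintro ⟨g, rfl⟩
      refine ⟨⟨Set.mem_iInter.2 fun x => g.symm_apply_apply x,
        Set.mem_iInter.2 fun x => g.apply_symm_apply x⟩,
        Set.mem_iInter₂.2 fun x y => g.map_adj_iff⟩
    · rintro ⟨⟨h1, h2⟩, h3⟩
      exact ⟨⟨⟨p.1, p.2, fun x => Set.mem_iInter.1 h1 x, fun x => Set.mem_iInter.1 h2 x⟩,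
        fun {x y} => Set.mem_iInter₂.1 h3 x y⟩, rfl⟩
  have hV2 : ∀ s : Set (V × V), IsClosed s := fun s => isClosed_discrete s
  have hcomp : ∀ x, Continuous fun p : (V → V) × (V → V) => p.2 (p.1 x) := by
    intro x
    rw [continuous_discrete_rng]
    intro b
    have : (fun p : (V → V) × (V → V) => p.2 (p.1 x)) ⁻¹' {b} =
        ⋃ y, (fun p : (V → V) × (V → V) => p.1 x) ⁻¹' {y} ∩
          (fun p : (V → V) × (V → V) => p.2 y) ⁻¹' {b} := by
      ext p; simp
    rw [this]
    exact isOpen_iUnion fun y => ((isOpen_discrete _).preimage (hc x)).inter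
      ((isOpen_discrete _).preimage (hc' y))
  have hcomp' : ∀ x, Continuous fun p : (V → V) × (V → V) => p.1 (p.2 x) := by
    intro x
    exact (hcomp x).comp continuous_swap
  have hclosed : IsClosed (Set.range (pairOfFuns : Aut G → _)) := by
    rw [hrange]
    refine ((isClosed_iInter fun x => ?_).inter (isClosed_iInter fun x => ?_)).inter
      (isClosed_iInter fun x => isClosed_iInter fun y => ?_)
    · exact (isClosed_discrete {x}).preimage (hcomp x)
    · exact (isClosed_discrete {x}).preimage (hcomp' x)
    · exact (hV2 {q | G.Adj q.1 q.2 ↔ G.Adj x y}).preimage ((hc x).prodMk (hc y))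
  have : PolishSpace ((V → V) × (V → V)) := {}
  have : PolishSpace (Aut G) :=
    (IsClosedEmbedding.mk ⟨hind, hinj⟩ hclosed : IsClosedEmbedding pairOfFuns).polishSpace
  infer_instance

end Topology

/-! ### Induced permutations, consequences of non-stabilization, flexible families -/

section Components

variable {n : ℕ}

@[simp]
theorem inducedPerm_mul (f g : Aut (nKomega n)) :
    inducedPerm (f * g) = inducedPerm f * inducedPerm g := by
  ext i : 1
  exact (inducedPerm_fst f (g (i, 0))).symm

/-- The homomorphism from the automorphism group of `n K_ω` to the symmetric group `S_n`. -/
def inducedPermHom (n : ℕ) : Aut (nKomega n) →* Equiv.Perm (Fin n) :=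
  MonoidHom.mk' inducedPerm inducedPerm_mul

@[simp]
theorem inducedPerm_inv (f : Aut (nKomega n)) : inducedPerm f⁻¹ = (inducedPerm f)⁻¹ :=
  map_inv (inducedPermHom n) f

@[simp]
theorem inducedPerm_pow (f : Aut (nKomega n)) (k : ℕ) : inducedPerm (f ^ k) = inducedPerm f ^ k :=
  map_pow (inducedPermHom n) f k

/-- The automorphism given by a permutation of the vertices that permutes the components. -/
def autOfPerm (c : Equiv.Perm (Fin n × ℕ)) (p : Equiv.Perm (Fin n))
    (h : ∀ x, (c x).1 = p x.1) : Aut (nKomega n) where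
  toEquiv := c
  map_rel_iff' := by
    intro x y
    change (c x).1 = (c y).1 ∧ (c x).2 ≠ (c y).2 ↔ x.1 = y.1 ∧ x.2 ≠ y.2
    rw [h, h, p.injective.eq_iff]
    refine and_congr_right fun hxy => not_congr ⟨fun h2 => ?_, fun h2 => by rw [Prod.ext hxy h2]⟩
    rw [c.injective (Prod.ext (by rw [h, h, hxy]) h2)]

theorem inducedPerm_autOfPerm (c : Equiv.Perm (Fin n × ℕ)) (p : Equiv.Perm (Fin n))
    (h : ∀ x, (c x).1 = p x.1) : inducedPerm (autOfPerm c p h) = p := by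
  ext i : 1
  exact h (i, 0)

theorem map_closure_pair (f g : Aut (nKomega n)) :
    (Subgroup.closure {f, g}).map (inducedPermHom n) =
      Subgroup.closure {inducedPerm f, inducedPerm g} := by
  rw [MonoidHom.map_closure, Set.image_pair]
  rfl

/-- The automorphism of `n K_ω` that permutes the components and fixes the second coordinates. -/
def permuteComponents (p : Equiv.Perm (Fin n)) : Aut (nKomega n) :=
  autOfPerm (Equiv.prodCongr p (Equiv.refl ℕ)) p fun _ => rfl

theorem permuteComponents_apply (p : Equiv.Perm (Fin n)) (x : Fin n × ℕ) :
    permuteComponents p x = (p x.1, x.2) := rfl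

theorem inducedPerm_permuteComponents (p : Equiv.Perm (Fin n)) :
    inducedPerm (permuteComponents p) = p := inducedPerm_autOfPerm _ _ _

theorem inducedPerm_eq_of_agree {g h : Aut (nKomega n)} {F : Finset (Fin n × ℕ)}
    (hF : ∀ i, (i, 0) ∈ F) (H : ∀ x ∈ F, h x = g x) : inducedPerm h = inducedPerm g := by
  ext i : 1
  exact congrArg Prod.fst (H _ (hF i))

/-- The base points `(i, 0)` of the components. -/
def basePoints (n : ℕ) : Finset (Fin n × ℕ) := Finset.univ.image fun i => (i, 0)

theorem mem_basePoints (i : Fin n) : (i, 0) ∈ basePoints n := by simp [basePoints]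

/-- The values on the finitely many base points determine the induced permutation, so a dense
subgroup induces every permutation. -/
theorem denseMates_subset_genMates (f : Aut (nKomega n)) : denseMates f ⊆ genMates f := by
  intro g hg
  rw [denseMates, Set.mem_ofPred_eq, dense_iff_agree] at hg
  rw [genMates, Set.mem_ofPred_eq, eq_top_iff, ← map_closure_pair]
  intro p _
  obtain ⟨h, hh, H⟩ := hg (permuteComponents p) (basePoints n)
  exact ⟨h, hh, (inducedPerm_eq_of_agree mem_basePoints H).trans
    (inducedPerm_permuteComponents p)⟩

theorem isOpen_genMates (f : Aut (nKomega n)) : IsOpen (genMates f) := by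
  refine isOpen_iff_agree.2 fun g hg => ⟨basePoints n, fun h hh => ?_⟩
  rw [genMates, Set.mem_ofPred_eq, inducedPerm_eq_of_agree mem_basePoints hh]
  exact hg

theorem inv_mem_genMates {f g : Aut (nKomega n)} (hg : g ∈ genMates f) : g⁻¹ ∈ genMates f := by
  rw [genMates, Set.mem_ofPred_eq] at hg ⊢
  rw [eq_top_iff, ← hg, Subgroup.closure_le]
  rintro _ (rfl | rfl)
  · exact Subgroup.subset_closure (by simp)
  · rw [← inv_inv (inducedPerm g), ← inducedPerm_inv]
    exact inv_mem (Subgroup.subset_closure (by simp))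

theorem mem_genMates_of_perm_eq {f g h : Aut (nKomega n)} (hg : g ∈ genMates f)
    (H : inducedPerm h = inducedPerm g) : h ∈ genMates f := by
  rw [genMates, Set.mem_ofPred_eq, H]
  exact hg

/-- Elements of `⟨f, g⟩` preserve every finite set that is preserved by `f` and `g`. -/
theorem closure_preserves {V : Type*} {G : SimpleGraph V} {f g h : Aut G} {A : Finset V}
    (hf : ∀ x ∈ A, f x ∈ A) (hg : ∀ x ∈ A, g x ∈ A) (hh : h ∈ Subgroup.closure {f, g}) :
    ∀ x ∈ A, h x ∈ A := by
  induction hh using Subgroup.closure_induction with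
  | mem k hk =>
    rcases hk with rfl | rfl
    exacts [hf, hg]
  | one => exact fun x hx => hx
  | mul k l _ _ ihk ihl => exact fun x hx => ihk _ (ihl x hx)
  | inv k _ ih =>
    intro x hx
    obtain ⟨y, hy, rfl⟩ := Finset.surj_on_of_inj_on_of_card_le (s := A) (t := A)
      (fun a _ => k a) (fun a ha => ih a ha) (fun a b _ _ hab => k.injective hab) le_rfl x hx
    rwa [RelIso.inv_apply_self]

/-- Otherwise every extension of `g` restricted to `A` preserves `A` together with `f`, so no point
of `A` could be moved out of the proper subset `A`. -/
theorem NonStabilizing.not_preserves {f : Aut (nKomega n)} (hf : NonStabilizing f)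
    {g : Aut (nKomega n)} (hg : g ∈ genMates f) {A : Finset (Fin n × ℕ)} (hA : A.Nonempty)
    (hfA : ∀ x ∈ A, f x ∈ A) (hgA : ∀ x ∈ A, g x ∈ A) : False := by
  classical
  obtain ⟨x, hx⟩ := hA
  have : Nonempty (Fin n) := ⟨x.1⟩
  obtain ⟨g', ⟨hg', -⟩, h, hh, hx'⟩ := hf A
    ((Set.ssubset_univ_iff).2 fun h => Set.infinite_univ (h ▸ A.finite_toSet)) x hx
    (PartialIso.restrict g A) ⟨g, PartialIso.mem_extensions_restrict.2 fun _ _ => rfl, hg⟩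
  rw [PartialIso.mem_extensions_restrict] at hg'
  exact hx' (closure_preserves hfA (fun y hy => by rw [hg' y hy]; exact hgA y hy) hh x hx)

/-- If `f` moved only finitely many vertices, it would fix a whole row `(i, a)`, and so would
preserve it together with an automorphism that acts on rows only through the induced permutation of
`g`. -/
theorem NonStabilizing.exists_infinite_moved [NeZero n] {f : Aut (nKomega n)}
    (hf : NonStabilizing f) {g : Aut (nKomega n)} (hg : g ∈ genMates f) :
    ∃ i, {x | x.1 = i ∧ f x ≠ x}.Infinite := by
  by_contra! H
  have hfin : (⋃ i, {x | x.1 = i ∧ f x ≠ x}).Finite :=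
    Set.finite_iUnion H
  obtain ⟨a, ha⟩ := (hfin.image Prod.snd).infinite_compl.nonempty
  have hfix : ∀ i, f (i, a) = (i, a) := by
    intro i
    by_contra hi
    exact ha ⟨(i, a), Set.mem_iUnion.2 ⟨i, rfl, hi⟩, rfl⟩
  refine hf.not_preserves (mem_genMates_of_perm_eq hg (inducedPerm_permuteComponents _))
    (A := Finset.univ.image fun i => (i, a)) ⟨((0 : Fin n), a), by simp⟩ ?_ ?_
  · intro x hx
    obtain ⟨i, -, rfl⟩ := Finset.mem_image.1 hx
    rwa [hfix]
  · intro x hx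
    obtain ⟨i, -, rfl⟩ := Finset.mem_image.1 hx
    simp [permuteComponents_apply]

/-- A family of automorphisms whose members can be modified freely away from finite sets: a value
that is not prescribed can be moved to almost every vertex of the right component. -/
structure Flexible (f : Aut (nKomega n)) (S : Finset (Fin n × ℕ)) (X : Set (Aut (nKomega n))) :
    Prop where
  subset_genMates : X ⊆ genMates f
  inv_mem : ∀ g ∈ X, g⁻¹ ∈ X
  conj_mem : ∀ g ∈ X, ∀ c : Aut (nKomega n), inducedPerm c = 1 → (∀ x ∈ S, c x = x) →
    c * g * c⁻¹ ∈ X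
  exists_modification : ∀ g ∈ X, ∀ (F B : Finset (Fin n × ℕ)) (z : Fin n × ℕ), z ∉ F →
    ∀ M : Set (Fin n × ℕ), M.Infinite → (∀ y ∈ M, y.1 = inducedPerm g z.1) →
      ∃ g' ∈ X, inducedPerm g' = inducedPerm g ∧ (∀ x ∈ F, g' x = g x) ∧ g' z ∈ M ∧ g' z ∉ B

/-- The transposition of two vertices in the same component. -/
def swapAut (a b : Fin n × ℕ) (h : a.1 = b.1) : Aut (nKomega n) :=
  autOfPerm (Equiv.swap a b) 1 fun x => by
    rw [Equiv.swap_apply_def, Equiv.Perm.one_apply]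
    split_ifs with h1 h2
    · rw [h1, h]
    · rw [h2, h]
    · rfl

theorem swapAut_apply (a b : Fin n × ℕ) (h : a.1 = b.1) (x : Fin n × ℕ) :
    swapAut a b h x = Equiv.swap a b x := rfl

theorem inducedPerm_swapAut (a b : Fin n × ℕ) (h : a.1 = b.1) : inducedPerm (swapAut a b h) = 1 :=
  inducedPerm_autOfPerm _ _ _

theorem inducedPerm_conj (g c : Aut (nKomega n)) (hc : inducedPerm c = 1) :
    inducedPerm (c * g * c⁻¹) = inducedPerm g := by
  simp [hc]

/-- Membership depends only on the induced permutation, so a value may be exchanged by a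
transposition inside its component. -/
theorem flexible_genMates (f : Aut (nKomega n)) : Flexible f ∅ (genMates f) where
  subset_genMates := le_rfl
  inv_mem _ hg := inv_mem_genMates hg
  conj_mem g hg c hc _ := mem_genMates_of_perm_eq hg (inducedPerm_conj g c hc)
  exists_modification := by
    classical
    intro g hg F B z hz M hM hMz
    obtain ⟨y, hyM, hy⟩ := hM.exists_notMem_finset (B ∪ F.image g)
    rw [Finset.mem_union, not_or] at hy
    have hyz : (g z).1 = y.1 := by rw [← inducedPerm_fst, hMz y hyM]
    have hperm : inducedPerm (swapAut (g z) y hyz * g) = inducedPerm g := by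
      rw [inducedPerm_mul, inducedPerm_swapAut, one_mul]
    refine ⟨swapAut (g z) y hyz * g, mem_genMates_of_perm_eq hg hperm, hperm, fun x hx => ?_, ?_⟩
    · rw [RelIso.mul_apply, swapAut_apply, Equiv.swap_apply_of_ne_of_ne]
      · exact fun h => hz (g.injective h ▸ hx)
      · exact fun h => hy.2 (h ▸ Finset.mem_image_of_mem g hx)
    · rw [RelIso.mul_apply, swapAut_apply, Equiv.swap_apply_left]
      exact ⟨hyM, hy.1⟩

end Components

/-! ### Orbits and sets of orbit representatives -/

section Orbits

variable {V : Type*} {G : SimpleGraph V}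

/-- Two vertices are in the same orbit of `⟨g⟩`. -/
def SameOrbit (g : Aut G) (x y : V) : Prop := ∃ k : ℤ, (g ^ k) x = y

theorem SameOrbit.refl (g : Aut G) (x : V) : SameOrbit g x x := ⟨0, by simp⟩

theorem SameOrbit.symm {g : Aut G} {x y : V} (h : SameOrbit g x y) : SameOrbit g y x := by
  obtain ⟨k, rfl⟩ := h
  exact ⟨-k, by rw [zpow_neg, RelIso.inv_apply_self]⟩

theorem SameOrbit.trans {g : Aut G} {x y z : V} (h : SameOrbit g x y) (h' : SameOrbit g y z) :
    SameOrbit g x z := by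
  obtain ⟨k, rfl⟩ := h
  obtain ⟨l, rfl⟩ := h'
  exact ⟨l + k, by rw [zpow_add, RelIso.mul_apply]⟩

theorem SameOrbit.apply (g : Aut G) (x : V) : SameOrbit g x (g x) := ⟨1, by simp⟩

theorem SameOrbit.pow_apply (g : Aut G) (x : V) (k : ℕ) : SameOrbit g x ((g ^ k) x) :=
  ⟨k, by simp⟩

/-- Orbits are compared along a map that need not be equivariant: it is enough that one step of `g`
stays within an orbit of `h`. -/
theorem SameOrbit.map {g h : Aut G} {r : V → V} (H : ∀ x, SameOrbit h (r x) (r (g x))) {x y : V}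
    (hxy : SameOrbit g x y) : SameOrbit h (r x) (r y) := by
  obtain ⟨k, rfl⟩ := hxy
  induction k with
  | zero => simpa using SameOrbit.refl h (r x)
  | succ k ih =>
    rw [add_comm, zpow_add, RelIso.mul_apply, zpow_one]
    exact ih.trans (H _)
  | pred k ih =>
    refine ih.trans (SameOrbit.symm ?_)
    have := H ((g ^ (-(k : ℤ) - 1)) x)
    rwa [← RelIso.mul_apply, ← zpow_one_add, add_sub_cancel] at this

theorem isOrbitReps_iff {S : Set V} {g : Aut G} :
    IsOrbitReps S g ↔ (∀ x, ∃ s ∈ S, SameOrbit g x s) ∧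
      ∀ s ∈ S, ∀ t ∈ S, SameOrbit g s t → s = t := by
  constructor
  · intro h
    refine ⟨fun x => (h x).exists, fun s hs t ht hst => ?_⟩
    exact (h s).unique ⟨hs, SameOrbit.refl g s⟩ ⟨ht, hst⟩
  · rintro ⟨h1, h2⟩ x
    obtain ⟨s, hs, hxs⟩ := h1 x
    exact ⟨s, ⟨hs, hxs⟩, fun t ⟨ht, hxt⟩ => h2 t ht s hs ((SameOrbit.symm hxt).trans hxs)⟩

theorem IsOrbitReps.inv {S : Set V} {g : Aut G} (h : IsOrbitReps S g) : IsOrbitReps S g⁻¹ := by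
  rw [isOrbitReps_iff] at h ⊢
  have key : ∀ x y, SameOrbit g⁻¹ x y ↔ SameOrbit g x y := by
    intro x y
    constructor
    · rintro ⟨k, hk⟩
      exact ⟨-k, by rwa [zpow_neg, ← inv_zpow]⟩
    · rintro ⟨k, hk⟩
      exact ⟨-k, by rwa [inv_zpow, zpow_neg, inv_inv]⟩
  simpa only [key] using h

theorem IsOrbitReps.conj {S : Set V} {g c : Aut G} (h : IsOrbitReps S g) (hc : ∀ x ∈ S, c x = x) :
    IsOrbitReps S (c * g * c⁻¹) := by
  rw [isOrbitReps_iff] at h ⊢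
  have key : ∀ x y, SameOrbit g x y ↔ SameOrbit (c * g * c⁻¹) (c x) (c y) := by
    refine fun x y => exists_congr fun k => ?_
    rw [conj_zpow, RelIso.mul_apply, RelIso.mul_apply, RelIso.inv_apply_self,
      c.injective.eq_iff]
  refine ⟨fun x => ?_, fun s hs t ht hst => h.2 s hs t ht ?_⟩
  · obtain ⟨s, hs, hxs⟩ := h.1 (c⁻¹ x)
    refine ⟨s, hs, ?_⟩
    have := (key _ _).1 hxs
    rwa [RelIso.apply_inv_self, hc s hs] at this
  · rw [key, hc s hs, hc t ht]
    exact hst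

/-- If finitely many orbits cover everything, only finitely many points are periodic with a given
period. -/
theorem IsOrbitReps.finite_periodic {S : Finset V} {g : Aut G} (h : IsOrbitReps (S : Set V) g)
    {j : ℕ} (hj : 0 < j) : {y | (g ^ j) y = y}.Finite := by
  classical
  refine Set.Finite.subset
    ((S.biUnion fun s => (Finset.range j).image fun i => (g ^ i) s).finite_toSet) fun y hy => ?_
  obtain ⟨s, hs, hys⟩ := (isOrbitReps_iff.1 h).1 y
  obtain ⟨k, rfl⟩ := hys.symm
  have hs' : (g ^ j) s = s := by
    have hcomm : (g ^ j) ((g ^ k) s) = (g ^ k) ((g ^ j) s) := by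
      rw [← RelIso.mul_apply, ← RelIso.mul_apply, ← zpow_natCast, zpow_mul_comm]
    exact (g ^ k).injective (hcomm ▸ hy)
  have hmul : ∀ m : ℤ, ((g ^ j) ^ m) s = s := by
    intro m
    have h2 : ∀ m : ℕ, ((g ^ j) ^ m) s = s := by
      intro m
      induction m with
      | zero => simp
      | succ m ih => rw [pow_succ, RelIso.mul_apply, hs', ih]
    obtain ⟨m, rfl | rfl⟩ := m.eq_nat_or_neg
    · rw [zpow_natCast, h2]
    · rw [zpow_neg, zpow_natCast]
      conv_lhs => rw [← h2 m]
      rw [RelIso.inv_apply_self]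
  rw [Finset.mem_coe, Finset.mem_biUnion]
  refine ⟨s, hs, Finset.mem_image.2 ⟨(k % j).toNat, ?_, ?_⟩⟩
  · rw [Finset.mem_range]
    have := Int.emod_lt_of_pos k (Int.natCast_pos.2 hj)
    have := Int.emod_nonneg k (Int.natCast_pos.2 hj).ne'
    omega
  · have h0 := Int.emod_nonneg k (Int.natCast_pos.2 hj).ne'
    conv_rhs => rw [← Int.emod_add_mul_ediv k j, zpow_add, zpow_mul, zpow_natCast, RelIso.mul_apply,
      hmul]
    rw [← zpow_natCast, Int.toNat_of_nonneg h0]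

end Orbits

/-! ### Moving a block of an orbit without changing orbit representatives -/

section Insertion

variable {V : Type*} {G : SimpleGraph V}

/-- If `g'` arises from `g` by moving the block `y, g y, …, g ^ (r - 1) y` behind the point `z`, then
`g` and `g'` have the same sets of orbit representatives outside the block. -/
theorem IsOrbitReps.insertBlock {S : Set V} {g g' : Aut G} (h : IsOrbitReps S g) {y z : V} {r : ℕ}
    (hr : 0 < r) (hz : g' z = y) (hstart : g' (g⁻¹ y) = (g ^ r) y)
    (hend : g' ((g ^ (r - 1)) y) = g z)
    (hother : ∀ x, x ≠ z → x ≠ g⁻¹ y → x ≠ (g ^ (r - 1)) y → g' x = g x)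
    (hzB : ∀ i < r, (g ^ i) y ≠ z) (hzy : g⁻¹ y ≠ z)
    (hS : ∀ i < r, (g ^ i) y ∉ S)
    (hper : ∀ j, 0 < j → j ≤ r + 1 → (g ^ j) y ≠ y) :
    IsOrbitReps S g' := by
  classical
  -- The points `g⁻¹ y, y, …, g ^ r y` are distinct; comparing the first with the last is what needs
  -- periods up to `r + 1` excluded.
  have hinj : ∀ i j, i < j → j ≤ r → (g ^ i) y ≠ (g ^ j) y := by
    intro i j hij hjr heq
    obtain ⟨d, rfl⟩ := Nat.exists_eq_add_of_lt hij
    rw [add_assoc, pow_add, RelIso.mul_apply, (g ^ i).injective.eq_iff] at heq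
    exact hper (d + 1) (by omega) (by omega) heq.symm
  have hpred : ∀ i, i ≤ r → (g ^ i) y ≠ g⁻¹ y := by
    intro i hi heq
    have := congrArg g heq
    rw [RelIso.apply_inv_self, ← RelIso.mul_apply, ← pow_succ'] at this
    exact hper (i + 1) (by omega) (by omega) this
  have hstep : ∀ i, i + 1 < r → g' ((g ^ i) y) = (g ^ (i + 1)) y := by
    intro i hi
    rw [hother _ (hzB i (by omega)) (hpred i (by omega)) (hinj i (r - 1) (by omega) (by omega)),
      pow_succ', RelIso.mul_apply]
  have hblock : ∀ i, i < r → SameOrbit g' z ((g ^ i) y) := by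
    intro i hi
    induction i with
    | zero =>
      have := SameOrbit.apply g' z
      rwa [hz] at this
    | succ i ih =>
      have := SameOrbit.apply g' ((g ^ i) y)
      rw [hstep i hi] at this
      exact (ih (by omega)).trans this
  have hgz : ∀ i < r, (g ^ i) y ≠ g z := by
    rintro (_ | i) hi heq
    · apply hzy
      rw [pow_zero, RelIso.one_apply] at heq
      rw [heq, RelIso.inv_apply_self]
    · rw [pow_succ', RelIso.mul_apply, g.injective.eq_iff] at heq
      exact hzB i (by omega) heq
  have hpre : ∀ x, (∀ i < r, (g ^ i) y ≠ x) → x ≠ g⁻¹ y → ∀ i < r, (g ^ i) y ≠ g x := by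
    rintro x hx hxy (_ | i) hi heq
    · apply hxy
      rw [pow_zero, RelIso.one_apply] at heq
      rw [heq, RelIso.inv_apply_self]
    · rw [pow_succ', RelIso.mul_apply, g.injective.eq_iff] at heq
      exact hx i (by omega) heq
  have hlast : g ((g ^ (r - 1)) y) = (g ^ r) y := by
    rw [← RelIso.mul_apply, ← pow_succ', Nat.sub_add_cancel hr]
  set P : V → Prop := fun x => ∃ i < r, (g ^ i) y = x
  have hnP : ∀ x, ¬ P x → ∀ i < r, (g ^ i) y ≠ x := fun x hx i hi he => hx ⟨i, hi, he⟩
  have hr_not : ¬ P ((g ^ r) y) := fun ⟨i, hi, he⟩ => hinj i r hi le_rfl he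
  rw [isOrbitReps_iff] at h ⊢
  constructor
  · intro x
    -- Collapsing the block to the point that followed it turns orbits of `g` into parts of orbits
    -- of `g'`.
    have key : ∀ x, SameOrbit g' (if P x then (g ^ r) y else x)
        (if P (g x) then (g ^ r) y else g x) := by
      intro x
      by_cases hx : P x
      · rw [if_pos hx]
        obtain ⟨i, hi, rfl⟩ := hx
        rcases Nat.lt_or_ge (i + 1) r with h1 | h1
        · rw [if_pos ⟨i + 1, h1, by rw [pow_succ', RelIso.mul_apply]⟩]
          exact SameOrbit.refl _ _
        · obtain rfl : i = r - 1 := by omega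
          rw [hlast, if_neg hr_not]
          exact SameOrbit.refl _ _
      · rw [if_neg hx]
        by_cases hxy : x = g⁻¹ y
        · rw [if_pos ⟨0, hr, by rw [hxy]; simp⟩, ← hstart, ← hxy]
          exact SameOrbit.apply _ _
        · rw [if_neg fun ⟨i, hi, he⟩ => hpre x (hnP x hx) hxy i hi he]
          by_cases hxz : x = z
          · rw [hxz]
            refine (hblock (r - 1) (by omega)).trans ?_
            rw [← hend]
            exact SameOrbit.apply _ _
          · rw [← hother x hxz hxy fun h => hnP x hx (r - 1) (by omega) h.symm]
            exact SameOrbit.apply _ _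
    have hout : ∀ x, ¬ P x → ∃ s ∈ S, SameOrbit g' x s := by
      intro x hx
      obtain ⟨s, hs, hxs⟩ := h.1 x
      have := SameOrbit.map key hxs
      rw [if_neg hx, if_neg fun ⟨i, hi, he⟩ => hS i hi (by rwa [he])] at this
      exact ⟨s, hs, this⟩
    by_cases hx : P x
    · obtain ⟨i, hi, rfl⟩ := hx
      obtain ⟨s, hs, hzs⟩ := hout z fun ⟨i, hi, he⟩ => hzB i hi he
      exact ⟨s, hs, (hblock i hi).symm.trans hzs⟩
    · exact hout x hx
  · intro s hs t ht hst
    apply h.2 s hs t ht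
    have hzP : ¬ P z := fun ⟨i, hi, he⟩ => hzB i hi he
    -- In the other direction the block is collapsed to `z`, behind which it now stands.
    have key : ∀ x, SameOrbit g (if P x then z else x) (if P (g' x) then z else g' x) := by
      intro x
      by_cases hx : P x
      · rw [if_pos hx]
        obtain ⟨i, hi, rfl⟩ := hx
        rcases Nat.lt_or_ge (i + 1) r with h1 | h1
        · rw [hstep i h1, if_pos ⟨i + 1, h1, rfl⟩]
          exact SameOrbit.refl _ _
        · obtain rfl : i = r - 1 := by omega
          rw [hend, if_neg fun ⟨i, hi, he⟩ => hgz i hi he]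
          exact SameOrbit.apply _ _
      · rw [if_neg hx]
        by_cases hxz : x = z
        · rw [hxz, hz, if_pos ⟨0, hr, by simp⟩]
          exact SameOrbit.refl _ _
        by_cases hxy : x = g⁻¹ y
        · rw [hxy, hstart, if_neg hr_not]
          refine SameOrbit.trans ?_ (SameOrbit.pow_apply g y r)
          have := SameOrbit.apply g (g⁻¹ y)
          rwa [RelIso.apply_inv_self] at this
        · rw [hother x hxz hxy fun h => hnP x hx (r - 1) (by omega) h.symm,
            if_neg fun ⟨i, hi, he⟩ => hpre x (hnP x hx) hxy i hi he]
          exact SameOrbit.apply _ _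
    have := SameOrbit.map key hst
    rwa [if_neg fun ⟨i, hi, he⟩ => hS i hi (by rwa [he]),
      if_neg fun ⟨i, hi, he⟩ => hS i hi (by rwa [he])] at this

end Insertion

/-! ### Flexibility in the presence of orbit representatives -/

section Components

variable {n : ℕ}

/-- A single transposition might merge or split orbits. Instead a whole block `y, …, g ^ (r - 1) y`
free of representatives is cut out and inserted behind `z`. -/
theorem flexible_genMatesWithReps (f : Aut (nKomega n)) (S : Finset (Fin n × ℕ)) :
    Flexible f S (genMatesWithReps f (S : Set (Fin n × ℕ))) where
  subset_genMates _ hg := hg.1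
  inv_mem _ hg := ⟨inv_mem_genMates hg.1, hg.2.inv⟩
  conj_mem g hg c hc hS := ⟨mem_genMates_of_perm_eq hg.1 (inducedPerm_conj g c hc), hg.2.conj hS⟩
  exists_modification := by
    classical
    intro g hg F B z hz M hM hMz
    -- With this block length `g ^ r y` lies in the component of `y`, so the gap left by the block
    -- can be closed within components.
    set r := orderOf (inducedPerm g)
    have hr : 0 < r := orderOf_pos _
    have hfin : (⋃ j ∈ Finset.Icc 1 (r + 1), {y | (g ^ j) y = y}).Finite :=
      Set.Finite.biUnion (Finset.finite_toSet _) fun j hj =>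
        hg.2.finite_periodic (Finset.mem_Icc.1 hj).1
    -- The excluded images ensure that none of `g⁻¹ y, y, …, g ^ r y` lies in `F ∪ S ∪ {z}`: the
    -- index `0` handles `g⁻¹ y`, and `i + 1` handles `g ^ i y`.
    obtain ⟨y, ⟨hyM, hyper⟩, hy⟩ := (hM.sdiff hfin).exists_notMem_finset
      (B ∪ (Finset.range (r + 2)).biUnion fun i => (F ∪ S ∪ {z}).image fun x => g ((g ^ i)⁻¹ x))
    simp only [Finset.mem_union, not_or, Finset.mem_biUnion, Finset.mem_image, not_exists,
      Finset.mem_range, Finset.mem_singleton, not_and] at hy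
    have hy0 : ∀ x, (x ∈ F ∨ x ∈ S) ∨ x = z → g⁻¹ y ≠ x := by
      intro x hx he
      refine hy.2 0 (by omega) x hx ?_
      rw [← he]
      simp
    have hyi : ∀ i ≤ r, ∀ x, (x ∈ F ∨ x ∈ S) ∨ x = z → (g ^ i) y ≠ x := by
      intro i hi x hx he
      refine hy.2 (i + 1) (by omega) x hx ?_
      rw [← he, pow_succ, mul_inv_rev, RelIso.mul_apply, RelIso.inv_apply_self,
        RelIso.apply_inv_self]
    have hper : ∀ j, 0 < j → j ≤ r + 1 → (g ^ j) y ≠ y := by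
      intro j h1 h2 he
      exact hyper (Set.mem_biUnion (Finset.mem_Icc.2 ⟨h1, h2⟩) he)
    have hyz : (g z).1 = y.1 := by rw [← inducedPerm_fst, hMz y hyM]
    have hyr : y.1 = ((g ^ r) y).1 := by
      rw [← inducedPerm_fst, inducedPerm_pow, pow_orderOf_eq_one, Equiv.Perm.one_apply]
    have hab : g z ≠ y := fun he => hy0 z (Or.inr rfl) (by rw [← he, RelIso.inv_apply_self])
    have hlast : g ((g ^ (r - 1)) y) = (g ^ r) y := by
      rw [← RelIso.mul_apply, ← pow_succ', Nat.sub_add_cancel hr]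
    have hac : g z ≠ (g ^ r) y := fun he => by
      rw [← hlast, g.injective.eq_iff] at he
      exact hyi (r - 1) (by omega) z (Or.inr rfl) he.symm
    have hbc : (g ^ r) y ≠ y := hper r hr (by omega)
    -- The inner transposition, acting first, closes the gap and turns the block into a cycle; the
    -- outer one splices that cycle in behind `z`.
    set g' : Aut (nKomega n) := swapAut (g z) y hyz * swapAut y ((g ^ r) y) hyr * g with hg'
    have happ : ∀ x, g' x = Equiv.swap (g z) y (Equiv.swap y ((g ^ r) y) (g x)) := fun x => rfl
    have hperm : inducedPerm g' = inducedPerm g := by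
      rw [hg', inducedPerm_mul, inducedPerm_mul, inducedPerm_swapAut, inducedPerm_swapAut, one_mul,
        one_mul]
    have h1 : g' z = y := by
      rw [happ, Equiv.swap_apply_of_ne_of_ne hab hac, Equiv.swap_apply_left]
    have h2 : g' (g⁻¹ y) = (g ^ r) y := by
      rw [happ, RelIso.apply_inv_self, Equiv.swap_apply_left,
        Equiv.swap_apply_of_ne_of_ne hac.symm hbc]
    have h3 : g' ((g ^ (r - 1)) y) = g z := by
      rw [happ, hlast, Equiv.swap_apply_right, Equiv.swap_apply_right]
    have h4 : ∀ x, x ≠ z → x ≠ g⁻¹ y → x ≠ (g ^ (r - 1)) y → g' x = g x := by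
      intro x hx1 hx2 hx3
      have e1 : g x ≠ g z := fun h => hx1 (g.injective h)
      have e2 : g x ≠ y := fun h => hx2 (by rw [← h, RelIso.inv_apply_self])
      have e3 : g x ≠ (g ^ r) y := fun h => hx3 (g.injective (h.trans hlast.symm))
      rw [happ, Equiv.swap_apply_of_ne_of_ne e2 e3, Equiv.swap_apply_of_ne_of_ne e1 e2]
    refine ⟨g', ⟨mem_genMates_of_perm_eq hg.1 hperm, ?_⟩, hperm, fun x hx => ?_, ?_, ?_⟩
    · exact hg.2.insertBlock hr h1 h2 h3 h4 (fun i hi => hyi i hi.le z (Or.inr rfl))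
        (hy0 z (Or.inr rfl))
        (fun i hi hS => hyi i hi.le _ (Or.inl (Or.inr (Finset.mem_coe.1 hS))) rfl) hper
    · exact h4 x (fun h => hz (h ▸ hx)) (fun h => hy0 x (Or.inl (Or.inl hx)) h.symm)
        (fun h => hyi (r - 1) (by omega) x (Or.inl (Or.inl hx)) h.symm)
    · rwa [h1]
    · rw [h1]
      exact hy.1

end Components

/-! ### Prescribing fresh values along orbits; private chains -/

section Runs

variable {n : ℕ} {K : Type*}

theorem pow_apply_eq_of_agree {V : Type*} {G : SimpleGraph V} {g g' : Aut G} {F : Finset V}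
    (H : ∀ x ∈ F, g' x = g x) {x : V} {N : ℕ} (hN : ∀ i < N, (g ^ i) x ∈ F) :
    (g' ^ N) x = (g ^ N) x := by
  induction N with
  | zero => rfl
  | succ N ih =>
    rw [pow_succ', pow_succ', RelIso.mul_apply, RelIso.mul_apply, ih fun i hi => hN i (by omega),
      H _ (hN N (by omega))]

/-- The vertices whose whole forward orbit under `g` stays in the finite set `F`. -/
def stuck {V : Type*} {G : SimpleGraph V} (g : Aut G) (F : Finset V) : Set V :=
  {x | ∀ N : ℕ, (g ^ N) x ∈ F}

theorem exists_period_of_mem_stuck {V : Type*} {G : SimpleGraph V} {g : Aut G} {F : Finset V}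
    {x : V} (hx : x ∈ stuck g F) : ∃ p, 0 < p ∧ (g ^ p) x = x := by
  obtain ⟨i, j, hij, he⟩ : ∃ i j : ℕ, i < j ∧ (g ^ i) x = (g ^ j) x := by
    obtain ⟨i, -, j, -, hij, he⟩ := Set.infinite_univ.exists_ne_map_eq_of_mapsTo
      (f := fun i : ℕ => (g ^ i) x) (fun i _ => hx i) F.finite_toSet
    rcases lt_or_gt_of_ne hij with h | h
    exacts [⟨i, j, h, he⟩, ⟨j, i, h, he.symm⟩]
  refine ⟨j - i, by omega, (g ^ i).injective ?_⟩
  rw [← RelIso.mul_apply, ← pow_add, Nat.add_sub_cancel' hij.le, he]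

/-- `f` either moves `y` out of `T`, or fixes `y`; the latter is forbidden in the component `i₀`. -/
def Good (f : Aut (nKomega n)) (i₀ : Fin n) (T : Finset (Fin n × ℕ)) (y : Fin n × ℕ) : Prop :=
  f y ∉ T ∨ (f y = y ∧ y.1 ≠ i₀)

/-- `g` arises from `g₀` by prescribing fresh values along the orbits of the points `e j`: the values
on `F₀` are kept, and `F` consists of `F₀` and the points `g ^ i (e j)` with `P j i`. All points that
have been met so far are in `T`. -/
structure IsRun (f : Aut (nKomega n)) (i₀ : Fin n) (X : Set (Aut (nKomega n)))
    (g₀ : Aut (nKomega n)) (F₀ T₀ : Finset (Fin n × ℕ)) (e : K → Fin n × ℕ)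
    (P : K → ℕ → Prop) (g : Aut (nKomega n)) (F T : Finset (Fin n × ℕ)) : Prop where
  mem : g ∈ X
  perm : inducedPerm g = inducedPerm g₀
  agree : ∀ x ∈ F₀, g x = g₀ x
  subset : F₀ ⊆ F
  eq_of_new : ∀ z ∈ F, z ∉ F₀ → ∃ j i, P j i ∧ z = (g ^ i) (e j)
  pow_mem : ∀ j i, P j i → (g ^ i) (e j) ∈ F
  fresh : ∀ z ∈ F, z ∉ F₀ → g z ∉ T₀ ∧ Good f i₀ T (g z)
  subset_right : T₀ ⊆ T
  subset_met : F ⊆ T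
  apply_mem : ∀ z ∈ F, g z ∈ T

variable {f : Aut (nKomega n)} {i₀ : Fin n} {S : Finset (Fin n × ℕ)} {X : Set (Aut (nKomega n))}
  {g₀ g : Aut (nKomega n)} {F₀ T₀ F T : Finset (Fin n × ℕ)} {e : K → Fin n × ℕ}
  {P : K → ℕ → Prop}

theorem infinite_component (i : Fin n) : {y : Fin n × ℕ | y.1 = i}.Infinite :=
  (Set.infinite_range_of_injective (Prod.mk_right_injective i)).mono
    (Set.range_subset_iff.2 fun _ => rfl)

/-- Only finitely many candidates are excluded: `T`, its image and its preimage under `f`. In `i₀`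
infinitely many remain among the points moved by `f`. -/
theorem Flexible.exists_fresh (hX : Flexible f S X)
    (hi₀ : {x | x.1 = i₀ ∧ f x ≠ x}.Infinite) (hg : g ∈ X) (T : Finset (Fin n × ℕ))
    {z : Fin n × ℕ} (hz : z ∉ F) :
    ∃ g' ∈ X, inducedPerm g' = inducedPerm g ∧ (∀ x ∈ F, g' x = g x) ∧ g' z ∉ T ∧ f (g' z) ∉ T ∧
      (∀ x ∈ T, f x ≠ g' z) ∧ ((g' z).1 = i₀ → f (g' z) ≠ g' z) := by
  classical
  have hM : {y : Fin n × ℕ | y.1 = inducedPerm g z.1 ∧ (y.1 = i₀ → f y ≠ y)}.Infinite := by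
    by_cases h : inducedPerm g z.1 = i₀
    · refine hi₀.mono fun y hy => ⟨hy.1.trans h.symm, fun _ => hy.2⟩
    · refine (infinite_component (inducedPerm g z.1)).mono fun y hy => ⟨hy, fun h' => ?_⟩
      exact absurd (hy.symm.trans h') h
  obtain ⟨g', hg', hperm, hagree, hzM, hzB⟩ := hX.exists_modification g hg F
    (T ∪ (T.image f ∪ T.image (f⁻¹ : Aut _))) z hz _ hM fun y hy => hy.1
  simp only [Finset.mem_union, not_or, Finset.mem_image, not_exists, not_and] at hzB
  refine ⟨g', hg', hperm, hagree, hzB.1, fun h => ?_, fun x hx => hzB.2.1 x hx, hzM.2⟩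
  exact hzB.2.2 _ h (RelIso.inv_apply_self f _)

theorem IsRun.extend (hX : Flexible f S X)
    (hi₀ : {x | x.1 = i₀ ∧ f x ≠ x}.Infinite)
    (he : ∀ j, e j ∈ T₀) (hP : ∀ j i i', i' ≤ i → P j i → P j i')
    (h : IsRun f i₀ X g₀ F₀ T₀ e P g F T) (k : K) (m : ℕ) (hm : ∀ i < m, P k i) :
    ∃ g' F' T', IsRun f i₀ X g₀ F₀ T₀ e (fun j i => P j i ∨ (j = k ∧ i = m)) g' F' T' := by
  by_cases hz : (g ^ m) (e k) ∈ F
  · refine ⟨g, F, T, h.mem, h.perm, h.agree, h.subset, fun z hz hz0 => ?_, ?_, h.fresh,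
      h.subset_right, h.subset_met, h.apply_mem⟩
    · obtain ⟨j, i, hji, rfl⟩ := h.eq_of_new z hz hz0
      exact ⟨j, i, Or.inl hji, rfl⟩
    · rintro j i (hji | ⟨rfl, rfl⟩)
      exacts [h.pow_mem j i hji, hz]
  set z := (g ^ m) (e k) with hzdef
  have hzT : z ∈ T := by
    rcases m with _ | m
    · exact h.subset_right (he k)
    · rw [hzdef, pow_succ', RelIso.mul_apply]
      exact h.apply_mem _ (h.pow_mem k m (hm m (by omega)))
  obtain ⟨g', hg', hperm, hagree, h1, h2, h3, h4⟩ := hX.exists_fresh hi₀ h.mem T hz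
  have hpow : ∀ j i, P j i → (g' ^ i) (e j) = (g ^ i) (e j) := fun j i hji =>
    pow_apply_eq_of_agree hagree fun i' hi' => h.pow_mem j i' (hP j i i' hi'.le hji)
  have hpowm : (g' ^ m) (e k) = z :=
    pow_apply_eq_of_agree hagree fun i' hi' => h.pow_mem k i' (hm i' hi')
  refine ⟨g', insert z F, insert (g' z) T, hg', hperm.trans h.perm,
    fun x hx => (hagree x (h.subset hx)).trans (h.agree x hx),
    h.subset.trans (Finset.subset_insert _ _), ?_, ?_, ?_,
    h.subset_right.trans (Finset.subset_insert _ _), ?_, ?_⟩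
  · intro x hx hx0
    rcases Finset.mem_insert.1 hx with rfl | hx
    · exact ⟨k, m, Or.inr ⟨rfl, rfl⟩, hpowm.symm⟩
    · obtain ⟨j, i, hji, rfl⟩ := h.eq_of_new x hx hx0
      exact ⟨j, i, Or.inl hji, (hpow j i hji).symm⟩
  · rintro j i (hji | ⟨rfl, rfl⟩)
    · rw [hpow j i hji]
      exact Finset.mem_insert_of_mem (h.pow_mem j i hji)
    · rw [hpowm]
      exact Finset.mem_insert_self _ _
  · intro x hx hx0
    rcases Finset.mem_insert.1 hx with rfl | hx
    · refine ⟨fun hh => h1 (h.subset_right hh), ?_⟩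
      by_cases hfix : f (g' z) = g' z
      · exact Or.inr ⟨hfix, fun hi => h4 hi hfix⟩
      · exact Or.inl fun hh => (Finset.mem_insert.1 hh).elim hfix h2
    · rw [hagree x hx]
      -- Enlarging `T` by `g' z` keeps older values good, because `f` maps no point met so far to
      -- `g' z`.
      refine ⟨(h.fresh x hx hx0).1, (h.fresh x hx hx0).2.imp_left fun hT hh => ?_⟩
      exact (Finset.mem_insert.1 hh).elim (h3 _ (h.apply_mem x hx)) hT
  · exact Finset.insert_subset (Finset.mem_insert_of_mem hzT)
      (h.subset_met.trans (Finset.subset_insert _ _))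
  · intro x hx
    rcases Finset.mem_insert.1 hx with rfl | hx
    · exact Finset.mem_insert_self _ _
    · rw [hagree x hx]
      exact Finset.mem_insert_of_mem (h.apply_mem x hx)

theorem exists_isRun [Finite K] (hX : Flexible f S X)
    (hi₀ : {x | x.1 = i₀ ∧ f x ≠ x}.Infinite) (hg₀ : g₀ ∈ X) (he : ∀ j, e j ∈ T₀) (hF : F₀ ⊆ T₀)
    (hgF : ∀ x ∈ F₀, g₀ x ∈ T₀) (N : ℕ) :
    ∃ g F T, IsRun f i₀ X g₀ F₀ T₀ e (fun _ i => i < N) g F T := by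
  classical
  cases nonempty_fintype K
  induction N with
  | zero =>
    exact ⟨g₀, F₀, T₀, hg₀, rfl, fun _ _ => rfl, le_rfl, fun z hz hz0 => absurd hz hz0,
      fun _ i hi => absurd hi (Nat.not_lt_zero i), fun z hz hz0 => absurd hz hz0, le_rfl, hF, hgF⟩
  | succ N ih =>
    have key : ∀ s : Finset K, ∃ g F T,
        IsRun f i₀ X g₀ F₀ T₀ e (fun j i => i < N ∨ (i = N ∧ j ∈ s)) g F T := by
      intro s
      induction s using Finset.induction_on with
      | empty => simpa using ih
      | insert k s _ ihs =>
        obtain ⟨g, F, T, h⟩ := ihs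
        obtain ⟨g', F', T', h'⟩ := h.extend hX hi₀ he (by
            rintro j i i' hi' (hi | ⟨rfl, hj⟩)
            · exact Or.inl (by omega)
            · exact hi'.lt_or_eq.imp_right fun h => ⟨h, hj⟩) k N
          fun i hi => Or.inl hi
        refine ⟨g', F', T', ?_⟩
        convert h' using 3 with j i
        rw [Finset.mem_insert]
        tauto
    obtain ⟨g, F, T, h⟩ := key Finset.univ
    refine ⟨g, F, T, ?_⟩
    convert h using 3 with j i
    rw [Nat.lt_succ_iff_lt_or_eq]
    simp

namespace IsRun

variable {N : ℕ}

theorem pow_apply_notMem (h : IsRun f i₀ X g₀ F₀ T₀ e (fun _ i => i < N) g F T) (hF : F₀ ⊆ T₀)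
    {x : Fin n × ℕ} (hx : x ∉ F₀) {m : ℕ} (hm : ∀ i < m, (g ^ i) x ∈ F) : (g ^ m) x ∉ F₀ := by
  induction m with
  | zero => exact hx
  | succ m ih =>
    rw [pow_succ', RelIso.mul_apply]
    exact fun hh => (h.fresh _ (hm m (by omega)) (ih fun i hi => hm i (by omega))).1 (hF hh)

/-- A run closes no new cycle: such a cycle would return to a starting point `e j`, but fresh values
avoid `T₀`. -/
theorem stuck_eq (h : IsRun f i₀ X g₀ F₀ T₀ e (fun _ i => i < N) g F T) (he : ∀ j, e j ∈ T₀)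
    (hF : F₀ ⊆ T₀) : stuck g F = stuck g₀ F₀ := by
  refine Set.Subset.antisymm (fun x hx => ?_) fun x hx M => ?_
  · have hall : ∀ M, (g ^ M) x ∈ F₀ := by
      intro M
      by_contra hM
      set w := (g ^ M) x with hw
      have hwF : ∀ m, (g ^ m) w ∈ F := fun m => by
        rw [hw, ← RelIso.mul_apply, ← pow_add]
        exact hx _
      obtain ⟨p, hp, hpw⟩ := exists_period_of_mem_stuck hwF
      obtain ⟨j, i, -, hij⟩ := h.eq_of_new w (hwF 0) hM
      have hper : (g ^ p) (e j) = e j := by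
        apply (g ^ i).injective
        rw [← RelIso.mul_apply, ← pow_add, add_comm, pow_add, RelIso.mul_apply, ← hij, hpw]
      have hper' : ∀ q, (g ^ (p * q)) (e j) = e j := by
        intro q
        induction q with
        | zero => rfl
        | succ q ih => rw [mul_add_one, pow_add, RelIso.mul_apply, hper, ih]
      have hle : i + 1 ≤ p * (i + 1) := Nat.le_mul_of_pos_left _ hp
      -- A multiple of the period that is at least `i + 1` leaves room to go on from `w = (g ^ i) (e
      -- j)` round to the predecessor of `e j`.
      have hback : g ((g ^ (p * (i + 1) - (i + 1))) w) = e j := by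
        rw [← RelIso.mul_apply, ← pow_succ', hij, ← RelIso.mul_apply, ← pow_add,
          show p * (i + 1) - (i + 1) + 1 + i = p * (i + 1) by omega, hper']
      refine (h.fresh _ (hwF (p * (i + 1) - (i + 1)))
        (h.pow_apply_notMem hF hM fun i _ => hwF i)).1 ?_
      rw [hback]
      exact he j
    intro M
    rw [pow_apply_eq_of_agree (fun y hy => (h.agree y hy).symm) fun i _ => hall i]
    exact hall M
  · rw [pow_apply_eq_of_agree h.agree fun i _ => hx i]
    exact h.subset (hx M)

/-- Once the orbit has left `F₀` every further prescribed value is fresh, including the last one. -/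
theorem good_of_notMem (h : IsRun f i₀ X g₀ F₀ T₀ e (fun _ i => i < N) g F T) (hF : F₀ ⊆ T₀)
    {k : K} {m : ℕ} (hm : (g₀ ^ m) (e k) ∉ F₀) (hmN : m < N) : Good f i₀ T ((g ^ N) (e k)) := by
  classical
  have hex : ∃ m, (g₀ ^ m) (e k) ∉ F₀ := ⟨m, hm⟩
  set l := Nat.find hex with hl
  have hlm : l ≤ m := Nat.find_min' hex hm
  have hlt : ∀ i < l, (g₀ ^ i) (e k) ∈ F₀ := fun i hi => not_not.1 (Nat.find_min hex hi)
  have hle : (g ^ l) (e k) ∉ F₀ := by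
    rw [pow_apply_eq_of_agree h.agree hlt]
    exact Nat.find_spec hex
  obtain ⟨d, rfl⟩ : ∃ d, N = l + d + 1 := ⟨N - l - 1, by omega⟩
  have hmem : ∀ i ≤ d, (g ^ i) ((g ^ l) (e k)) ∈ F := by
    intro i hi
    rw [← RelIso.mul_apply, ← pow_add]
    exact h.pow_mem k _ (by omega)
  rw [show l + d + 1 = 1 + (d + l) by omega, pow_add, pow_add, pow_one, RelIso.mul_apply,
    RelIso.mul_apply]
  exact (h.fresh _ (hmem d le_rfl) (h.pow_apply_notMem hF hle fun i hi => hmem i hi.le)).2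

theorem apply_ne (h : IsRun f i₀ X g₀ F₀ T₀ e P g F T) {b : Fin n × ℕ} (hb : b ∈ T₀)
    (hb0 : ∀ z ∈ F₀, g₀ z ≠ b) : ∀ z ∈ F, g z ≠ b := by
  intro z hz
  by_cases hz0 : z ∈ F₀
  · rw [h.agree z hz0]
    exact hb0 z hz0
  · exact fun he => (h.fresh z hz hz0).1 (he ▸ hb)

end IsRun

/-- The point `e k` is the end of a chain of prescribed values of `g` that contains no other `e j`
and no point of `B`. -/
def IsPrivate (g : Aut (nKomega n)) (F B : Finset (Fin n × ℕ)) (e : K → Fin n × ℕ) (k : K) : Prop :=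
  ∃ c a, e k = (g ^ a) c ∧ (∀ i < a, (g ^ i) c ∈ F) ∧ e k ∉ F ∧ (∀ z ∈ F, g z ≠ c) ∧
    (∀ i ≤ a, (g ^ i) c ∉ B) ∧ ∀ i < a, ∀ j, (g ^ i) c ≠ e j

/-- The chain is prolonged by `N` fresh points. Another tuple point on it could be traced back
either to a starting point on the old chain or to a prescribed preimage of `c`, and both are
excluded. -/
theorem IsPrivate.run {N : ℕ} {B : Finset (Fin n × ℕ)} {k : K} (hk : IsPrivate g₀ F₀ B e k)
    (h : IsRun f i₀ X g₀ F₀ T₀ e (fun _ i => i < N) g F T) (he : ∀ j, e j ∈ T₀)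
    (hF : F₀ ⊆ T₀) (hB : B ⊆ T₀) : IsPrivate g F B (fun j => (g ^ N) (e j)) k := by
  obtain ⟨c, a, hca, hcF, hkF, hc, hcB, hce⟩ := hk
  have hpow : ∀ i ≤ a, (g ^ i) c = (g₀ ^ i) c := fun i hi =>
    pow_apply_eq_of_agree h.agree fun i' hi' => hcF i' (by omega)
  have hcT : c ∈ T₀ := by
    rcases a with _ | a
    · rw [pow_zero, RelIso.one_apply] at hca
      exact hca ▸ he k
    · exact hF (hcF 0 (by omega))
  have hek : (g ^ a) c = e k := by rw [hpow a le_rfl, hca]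
  have hshift : ∀ i, (g ^ (i + a)) c = (g ^ i) (e k) := fun i => by
    rw [pow_add, RelIso.mul_apply, hek]
  have hnot : ∀ i ≤ N, (g ^ i) (e k) ∉ F₀ := fun i hi =>
    h.pow_apply_notMem hF hkF fun i' hi' => h.pow_mem k i' (by omega)
  have hfresh : ∀ i < N, (g ^ (i + 1)) (e k) ∉ T₀ := by
    intro i hi
    rw [pow_succ', RelIso.mul_apply]
    exact (h.fresh _ (h.pow_mem k i hi) (hnot i hi.le)).1
  have hcg := h.apply_ne hcT hc
  refine ⟨c, N + a, (hshift N).symm, fun i hi => ?_, fun hmem => ?_, hcg, fun i hi => ?_,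
    fun i hi j heq => ?_⟩
  · rcases Nat.lt_or_ge i a with hia | hia
    · rw [hpow i hia.le]
      exact h.subset (hcF i hia)
    · obtain ⟨d, rfl⟩ := Nat.exists_eq_add_of_le' hia
      rw [hshift]
      exact h.pow_mem k d (by omega)
  · obtain ⟨j, i, hi, heq⟩ := h.eq_of_new _ hmem (hnot N le_rfl)
    obtain ⟨d, rfl⟩ := Nat.exists_eq_add_of_lt hi
    dsimp only at heq
    rw [add_assoc, pow_add, RelIso.mul_apply, (g ^ i).injective.eq_iff] at heq
    exact hfresh d (by omega) (heq ▸ he j)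
  · rcases Nat.lt_or_ge a i with hia | hia
    · obtain ⟨d, rfl⟩ := Nat.exists_eq_add_of_lt hia
      rw [show a + d + 1 = d + 1 + a by omega, hshift]
      exact fun hh => hfresh d (by omega) (hB hh)
    · rw [hpow i hia]
      exact hcB i hia
  · dsimp only at heq
    rcases Nat.lt_or_ge i N with hiN | hiN
    · obtain ⟨d, rfl⟩ := Nat.exists_eq_add_of_lt hiN
      rw [add_assoc, pow_add, RelIso.mul_apply, (g ^ i).injective.eq_iff, pow_succ',
        RelIso.mul_apply] at heq
      exact hcg _ (h.pow_mem j d (by omega)) heq.symm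
    · obtain ⟨d, rfl⟩ := Nat.exists_eq_add_of_le hiN
      rw [pow_add, RelIso.mul_apply, (g ^ N).injective.eq_iff, hpow d (by omega)] at heq
      exact hce d (by omega) j heq

/-- Either `f` sends the end to an unmet vertex, which is a chain by itself, or `f` fixes the end
and the old chain serves. No other tuple point can land on the old chain, as each is fixed or leaves
`T`. -/
theorem IsPrivate.turn {B : Finset (Fin n × ℕ)} {k : K} (hk : IsPrivate g F B e k) (hF : F ⊆ T)
    (hgF : ∀ z ∈ F, g z ∈ T) (hB : B ⊆ T) (hgood : ∀ j, Good f i₀ T (e j)) :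
    IsPrivate g F B (fun j => f (e j)) k := by
  rcases hgood k with hfk | ⟨hfk, -⟩
  · exact ⟨f (e k), 0, rfl, fun i hi => absurd hi (Nat.not_lt_zero i), fun h => hfk (hF h),
      fun z hz h => hfk (h ▸ hgF z hz), fun i hi h => hfk (hB (by
        rwa [Nat.le_zero.1 hi] at h)), fun i hi => absurd hi (Nat.not_lt_zero i)⟩
  · obtain ⟨c, a, hca, hcF, hkF, hc, hcB, hce⟩ := hk
    refine ⟨c, a, hfk.trans hca, hcF, fun h => hkF (hfk ▸ h), hc, hcB, fun i hi j heq => ?_⟩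
    dsimp only at heq
    rcases hgood j with hfj | ⟨hfj, -⟩
    · exact hfj (heq ▸ hF (hcF i hi))
    · exact hce i hi j (heq.trans hfj)

theorem isPrivate_turn_of_notMem {B : Finset (Fin n × ℕ)} {k : K} (hF : F ⊆ T)
    (hgF : ∀ z ∈ F, g z ∈ T) (hB : B ⊆ T) (hk : e k ∉ T) :
    IsPrivate g F B e k :=
  ⟨e k, 0, rfl, fun i hi => absurd hi (Nat.not_lt_zero i), fun h => hk (hF h),
    fun z hz h => hk (h ▸ hgF z hz), fun i hi h => hk (hB (by
      rwa [Nat.le_zero.1 hi] at h)), fun i hi => absurd hi (Nat.not_lt_zero i)⟩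

end Runs

/-! ### Steering tuples by words in `f` and `g` -/

section Configurations

variable {n : ℕ} {K : Type*}

/-- An automorphism `g`, a set `F` on which its values are regarded as prescribed, and a tuple of
vertices. -/
structure Config (n : ℕ) (K : Type*) where
  /-- the automorphism -/
  g : Aut (nKomega n)
  /-- the set of vertices whose images are prescribed -/
  F : Finset (Fin n × ℕ)
  /-- the tuple -/
  e : K → Fin n × ℕ

/-- The configuration `t` prescribes more than `s`, and what it prescribes determines a word in `f`
and `t.g` that maps the tuple of `s` to that of `t`. No point of `B` gets a prescribed preimage. -/
structure Leads (f : Aut (nKomega n)) (X : Set (Aut (nKomega n))) (B : Finset (Fin n × ℕ))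
    (s t : Config n K) : Prop where
  mem : t.g ∈ X
  perm : inducedPerm t.g = inducedPerm s.g
  agree : ∀ x ∈ s.F, t.g x = s.g x
  subset : s.F ⊆ t.F
  carry : ∀ g' : Aut (nKomega n), (∀ x ∈ t.F, g' x = t.g x) →
    ∃ h ∈ Subgroup.closure {f, g'}, ∀ j, h (s.e j) = t.e j
  protect : ∀ b ∈ B, (∀ z ∈ s.F, s.g z ≠ b) → ∀ z ∈ t.F, t.g z ≠ b

variable {f : Aut (nKomega n)} {i₀ : Fin n} {S B : Finset (Fin n × ℕ)}
  {X : Set (Aut (nKomega n))} {s t u : Config n K}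

theorem Leads.refl (hs : s.g ∈ X) : Leads f X B s s :=
  ⟨hs, rfl, fun _ _ => rfl, le_rfl, fun _ _ => ⟨1, one_mem _, fun _ => rfl⟩, fun _ _ h => h⟩

theorem Leads.trans (h : Leads f X B s t) (h' : Leads f X B t u) : Leads f X B s u where
  mem := h'.mem
  perm := h'.perm.trans h.perm
  agree x hx := (h'.agree x (h.subset hx)).trans (h.agree x hx)
  subset := h.subset.trans h'.subset
  carry g' hg' := by
    obtain ⟨l, hl, hlu⟩ := h'.carry g' hg'
    obtain ⟨k, hk, hkt⟩ := h.carry g' fun x hx =>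
      (hg' x (h'.subset hx)).trans (h'.agree x hx)
    exact ⟨l * k, mul_mem hl hk, fun j => by rw [RelIso.mul_apply, hkt, hlu]⟩
  protect b hb hz := h'.protect b hb (h.protect b hb hz)

theorem Leads.injective (h : Leads f X B s t) (hs : Function.Injective s.e) :
    Function.Injective t.e := by
  obtain ⟨k, -, hk⟩ := h.carry t.g fun _ _ => rfl
  intro i j hij
  rw [← hk, ← hk] at hij
  exact hs (k.injective hij)

theorem Leads.exists_perm (h : Leads f X B s t) :
    ∃ p : Equiv.Perm (Fin n), ∀ j, (t.e j).1 = p (s.e j).1 := by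
  obtain ⟨k, -, hk⟩ := h.carry t.g fun _ _ => rfl
  exact ⟨inducedPerm k, fun j => by rw [← hk, inducedPerm_fst]⟩

/-- The effect of applying a large power of the automorphism of a configuration, with fresh
values, and then `f`. -/
structure IsMove (f : Aut (nKomega n)) (i₀ : Fin n) (B : Finset (Fin n × ℕ)) (s : Config n K) (N : ℕ)
    (t : Config n K) : Prop where
  stuck_eq : stuck t.g t.F = stuck s.g s.F
  notMem_stuck : ∀ j, s.e j ∉ stuck s.g s.F → t.e j ∉ stuck s.g s.F
  of_mem_stuck : ∀ j, s.e j ∈ stuck s.g s.F → t.e j = f ((s.g ^ N) (s.e j))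
  fst_eq : ∀ j, (t.e j).1 = (inducedPerm f * inducedPerm s.g ^ N) (s.e j).1
  isPrivate : (∀ j, s.e j ∉ stuck s.g s.F) → ∀ k, IsPrivate s.g s.F B s.e k →
    IsPrivate t.g t.F B t.e k
  isPrivate_of_eq : (∀ j, s.e j ∉ stuck s.g s.F) → ∀ k, (inducedPerm s.g ^ N) (s.e k).1 = i₀ →
    IsPrivate t.g t.F B t.e k

/-- The bound `N₀` is a time by which every tuple point that is not stuck has left the prescribed
domain, so that longer runs end at fresh values. -/
theorem exists_move [Finite K] (hX : Flexible f S X) (hi₀ : {x | x.1 = i₀ ∧ f x ≠ x}.Infinite)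
    (B : Finset (Fin n × ℕ)) (s : Config n K) (hs : s.g ∈ X) :
    ∃ N₀, ∀ N ≥ N₀, ∃ t, Leads f X B s t ∧ IsMove f i₀ B s N t := by
  classical
  cases nonempty_fintype K
  have hN₀ : ∃ N₀, ∀ j, s.e j ∉ stuck s.g s.F → ∃ m < N₀, (s.g ^ m) (s.e j) ∉ s.F := by
    have : ∀ j, ∃ m, s.e j ∉ stuck s.g s.F → (s.g ^ m) (s.e j) ∉ s.F := by
      intro j
      by_cases h : s.e j ∈ stuck s.g s.F
      · exact ⟨0, fun h' => absurd h h'⟩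
      · obtain ⟨m, hm⟩ := not_forall.1 h
        exact ⟨m, fun _ => hm⟩
    choose m hm using this
    exact ⟨∑ j, m j + 1, fun j hj => ⟨m j, Nat.lt_succ_of_le
      (Finset.single_le_sum (f := m) (fun _ _ => Nat.zero_le _) (Finset.mem_univ j)), hm j hj⟩⟩
  obtain ⟨N₀, hN₀⟩ := hN₀
  refine ⟨N₀, fun N hN => ?_⟩
  set T₀ := s.F ∪ (s.F.image s.g ∪ (B ∪ Finset.univ.image s.e)) with hT₀
  have hF : s.F ⊆ T₀ := Finset.subset_union_left
  have hgF : ∀ x ∈ s.F, s.g x ∈ T₀ := fun x hx => Finset.mem_union_right _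
    (Finset.mem_union_left _ (Finset.mem_image_of_mem _ hx))
  have hB : B ⊆ T₀ := Finset.subset_union_left.trans
    (Finset.subset_union_right.trans Finset.subset_union_right)
  have he : ∀ j, s.e j ∈ T₀ := fun j => Finset.mem_union_right _ (Finset.mem_union_right _
    (Finset.mem_union_right _ (Finset.mem_image_of_mem _ (Finset.mem_univ j))))
  obtain ⟨g, F, T, h⟩ := exists_isRun hX hi₀ hs he hF hgF N
  have hstuck := h.stuck_eq he hF
  have hgood : ∀ j, s.e j ∉ stuck s.g s.F → Good f i₀ T ((g ^ N) (s.e j)) := by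
    intro j hj
    obtain ⟨m, hm, hmF⟩ := hN₀ j hj
    exact h.good_of_notMem hF hmF (hm.trans_le hN)
  refine ⟨⟨g, F, fun j => f ((g ^ N) (s.e j))⟩,
    ⟨h.mem, h.perm, h.agree, h.subset, fun g' hg' => ⟨f * g' ^ N,
      mul_mem (Subgroup.subset_closure (by simp)) (pow_mem (Subgroup.subset_closure (by simp)) N),
      fun j => ?_⟩, fun b hb => h.apply_ne (hB hb)⟩, ⟨hstuck, ?_, ?_, ?_, ?_, ?_⟩⟩
  · rw [RelIso.mul_apply, pow_apply_eq_of_agree hg' fun i hi => h.pow_mem j i hi]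
  · intro j hj
    rcases hgood j hj with h1 | ⟨h1, -⟩
    · rw [← hstuck]
      exact fun h2 => h1 (h.subset_met (h2 0))
    -- If `f` fixes the endpoint and the endpoint is stuck, then so is `s.e j`, since the first `N`
    -- steps are prescribed as well.
    · dsimp only
      rw [h1, ← hstuck]
      intro h2
      rw [← hstuck] at hj
      refine hj fun M => ?_
      rcases Nat.lt_or_ge M N with hM | hM
      · exact h.pow_mem j M hM
      · obtain ⟨d, rfl⟩ := Nat.exists_eq_add_of_le' hM
        rw [pow_add, RelIso.mul_apply]
        exact h2 d
  · intro j hj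
    dsimp only
    rw [pow_apply_eq_of_agree h.agree fun i _ => hj i]
  · intro j
    dsimp only
    rw [← inducedPerm_fst, ← inducedPerm_fst, inducedPerm_pow, h.perm, Equiv.Perm.mul_apply]
  · intro hall k hk
    exact (hk.run h he hF hB).turn h.subset_met h.apply_mem (hB.trans h.subset_right)
      fun j => hgood j (hall j)
  · intro hall k hk
    refine isPrivate_turn_of_notMem h.subset_met h.apply_mem (hB.trans h.subset_right) ?_
    rcases hgood k (hall k) with h1 | ⟨-, h1⟩
    · exact h1
    · refine absurd ?_ h1
      rw [← inducedPerm_fst, inducedPerm_pow, h.perm, hk]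

/-- The exponents `0` and `1` give `a` and `a * b`, hence `b`, because inverses are positive powers
in a finite group. Thus the words `f * g ^ N` suffice to reach every permutation of the components.
-/
theorem closure_mul_pow_eq_top {G : Type*} [Group G] [Finite G] {a b : G}
    (h : Subgroup.closure {a, b} = ⊤) :
    Submonoid.closure (Set.range fun k : ℕ => a * b ^ k) = ⊤ := by
  set M := Submonoid.closure (Set.range fun k : ℕ => a * b ^ k) with hM
  have ha : a ∈ M := Submonoid.subset_closure ⟨0, by simp⟩
  have hab : a * b ∈ M := Submonoid.subset_closure ⟨1, by simp⟩
  have hai : a⁻¹ ∈ M := by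
    have : a⁻¹ = a ^ (orderOf a - 1) := by
      rw [inv_eq_iff_mul_eq_one, ← pow_succ', Nat.sub_add_cancel (orderOf_pos a),
        pow_orderOf_eq_one]
    rw [this]
    exact pow_mem ha _
  have hb : b ∈ M := by
    have := mul_mem hai hab
    rwa [inv_mul_cancel_left] at this
  rw [eq_top_iff, ← Subgroup.top_toSubmonoid, ← h, Subgroup.closure_toSubmonoid_of_finite,
    Submonoid.closure_le]
  rintro _ (rfl | rfl)
  exacts [ha, hb]

theorem exists_leads_perm [Finite K] (hX : Flexible f S X)
    (hi₀ : {x | x.1 = i₀ ∧ f x ≠ x}.Infinite) (B : Finset (Fin n × ℕ)) (s : Config n K)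
    (hs : s.g ∈ X) (hstuck : ∀ j, s.e j ∉ stuck s.g s.F) (p : Equiv.Perm (Fin n)) :
    ∃ t, Leads f X B s t ∧ (∀ j, t.e j ∉ stuck t.g t.F) ∧ (∀ j, (t.e j).1 = p (s.e j).1) ∧
      ∀ k, IsPrivate s.g s.F B s.e k → IsPrivate t.g t.F B t.e k := by
  have hp : p ∈ Submonoid.closure (Set.range fun k : ℕ => inducedPerm f * inducedPerm s.g ^ k) := by
    rw [closure_mul_pow_eq_top (hX.subset_genMates hs)]
    trivial
  induction hp using Submonoid.closure_induction_left with
  | one => exact ⟨s, Leads.refl hs, hstuck, fun _ => rfl, fun _ h => h⟩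
  | mul_left x hx p _ ih =>
    obtain ⟨k, rfl⟩ := hx
    obtain ⟨t, hst, ht, hp, hpriv⟩ := ih
    obtain ⟨N₀, hN₀⟩ := exists_move hX hi₀ B t hst.mem
    -- The exponent is congruent to `k` modulo the order of the induced permutation and at least
    -- `N₀`.
    obtain ⟨u, htu, hu⟩ := hN₀ (k + orderOf (inducedPerm s.g) * N₀)
      ((Nat.le_mul_of_pos_left _ (orderOf_pos _)).trans (Nat.le_add_left _ _))
    refine ⟨u, hst.trans htu, fun j => ?_, fun j => ?_, fun k hk => ?_⟩
    · rw [hu.stuck_eq]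
      exact hu.notMem_stuck j (ht j)
    · rw [hu.fst_eq, hp, hst.perm, pow_add, pow_mul, pow_orderOf_eq_one, one_pow, mul_one]
      rfl
    · exact hu.isPrivate ht k (hpriv k hk)

/-- The points are treated one at a time: the point is steered to `i₀`, where a good fresh value
cannot be fixed by `f`, so `f` sends it to an unmet vertex. Points that are already private remain
so. -/
theorem exists_leads_isPrivate [Finite K] (hX : Flexible f S X)
    (hi₀ : {x | x.1 = i₀ ∧ f x ≠ x}.Infinite) (B : Finset (Fin n × ℕ)) (s : Config n K)
    (hs : s.g ∈ X) (hstuck : ∀ j, s.e j ∉ stuck s.g s.F) :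
    ∃ t, Leads f X B s t ∧ (∀ j, t.e j ∉ stuck t.g t.F) ∧ ∀ k, IsPrivate t.g t.F B t.e k := by
  classical
  cases nonempty_fintype K
  have key : ∀ A : Finset K, ∃ t, Leads f X B s t ∧ (∀ j, t.e j ∉ stuck t.g t.F) ∧
      ∀ k ∈ A, IsPrivate t.g t.F B t.e k := by
    intro A
    induction A using Finset.induction_on with
    | empty => exact ⟨s, Leads.refl hs, hstuck, by simp⟩
    | insert k A _ ih =>
      obtain ⟨t, hst, ht, hpriv⟩ := ih
      obtain ⟨u, htu, hu, hperm, hpriv'⟩ := exists_leads_perm hX hi₀ B t hst.mem ht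
        (Equiv.swap (t.e k).1 i₀)
      obtain ⟨N₀, hN₀⟩ := exists_move hX hi₀ B u htu.mem
      obtain ⟨v, huv, hv⟩ := hN₀ (orderOf (inducedPerm u.g) * N₀)
        (Nat.le_mul_of_pos_left _ (orderOf_pos _))
      refine ⟨v, (hst.trans htu).trans huv, fun j => ?_, fun k' hk' => ?_⟩
      · rw [hv.stuck_eq]
        exact hv.notMem_stuck j (hu j)
      · rcases Finset.mem_insert.1 hk' with rfl | hk'
        · refine hv.isPrivate_of_eq hu _ ?_
          rw [pow_mul, pow_orderOf_eq_one, one_pow, Equiv.Perm.one_apply, hperm,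
            Equiv.swap_apply_left]
        · exact hv.isPrivate hu _ (hpriv' _ (hpriv _ hk'))
  obtain ⟨t, hst, ht, hpriv⟩ := key Finset.univ
  exact ⟨t, hst, ht, fun k => hpriv k (Finset.mem_univ k)⟩

/-- Points from which a composition of maps `f ∘ g ^ b` leads out of `Z`. -/
inductive Escapes {V : Type*} {G : SimpleGraph V} (f g : Aut G) (Z : Set V) : V → Prop
  | out (x : V) (hx : x ∉ Z) : Escapes f g Z x
  | step (x : V) (b : ℕ) (hx : Escapes f g Z (f ((g ^ b) x))) : Escapes f g Z x

/-- The points that never escape form a finite set closed under `f` and `f ∘ g`. By finiteness `f`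
permutes it, so `g` preserves it too, and it must be empty. -/
theorem escapes_of_not_preserves {V : Type*} {G : SimpleGraph V} {f g : Aut G} {Z : Set V}
    (hZ : Z.Finite)
    (H : ∀ A : Finset V, A.Nonempty → (∀ x ∈ A, f x ∈ A) → ¬ ∀ x ∈ A, g x ∈ A) (x : V) :
    Escapes f g Z x := by
  classical
  by_contra hx
  have hfin : {x | ¬ Escapes f g Z x}.Finite :=
    hZ.subset fun y hy => by_contra fun h => hy (Escapes.out y h)
  have hstep : ∀ y, ¬ Escapes f g Z y → ∀ b, ¬ Escapes f g Z (f ((g ^ b) y)) :=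
    fun y hy b h => hy (Escapes.step y b h)
  have hf : ∀ y ∈ hfin.toFinset, f y ∈ hfin.toFinset := by
    intro y hy
    rw [Set.Finite.mem_toFinset] at hy ⊢
    exact hstep y hy 0
  refine H hfin.toFinset ⟨x, by rwa [Set.Finite.mem_toFinset]⟩ hf fun y hy => ?_
  have hy' : f (g y) ∈ hfin.toFinset := by
    rw [Set.Finite.mem_toFinset] at hy ⊢
    simpa using hstep y hy 1
  obtain ⟨z, hz, hzy⟩ := Finset.surj_on_of_inj_on_of_card_le (s := hfin.toFinset)
    (t := hfin.toFinset) (fun a _ => f a) (fun a ha => hf a ha)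
    (fun a b _ _ hab => f.injective hab) le_rfl _ hy'
  rwa [f.injective hzy]

/-- Each stuck point follows an escape word. The stuck set does not change under moves, and points
that have left it do not return, so the tuple can be treated point by point. -/
theorem exists_leads_notMem_stuck [Finite K] (hX : Flexible f S X)
    (hi₀ : {x | x.1 = i₀ ∧ f x ≠ x}.Infinite) (hf : NonStabilizing f) (B : Finset (Fin n × ℕ))
    (s : Config n K) (hs : s.g ∈ X) :
    ∃ t, Leads f X B s t ∧ ∀ j, t.e j ∉ stuck t.g t.F := by
  classical
  cases nonempty_fintype K
  set Z := stuck s.g s.F with hZ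
  have hZfin : Z.Finite := s.F.finite_toSet.subset fun x hx => hx 0
  have hesc : ∀ x, Escapes f s.g Z x := escapes_of_not_preserves hZfin fun A hA h1 h2 =>
    hf.not_preserves (hX.subset_genMates hs) hA h1 h2
  have hgZ : ∀ x ∈ Z, s.g x ∈ Z := fun x hx N => by
    rw [← RelIso.mul_apply, ← pow_succ]
    exact hx _
  have hone : ∀ k x, Escapes f s.g Z x → ∀ t : Config n K, Leads f X B s t →
      stuck t.g t.F = Z → t.e k = x → ∃ u, Leads f X B s u ∧ stuck u.g u.F = Z ∧ u.e k ∉ Z ∧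
        ∀ j, t.e j ∉ Z → u.e j ∉ Z := by
    intro k x hx
    induction hx with
    | out x hx => exact fun t ht htZ htx => ⟨t, ht, htZ, htx ▸ hx, fun _ h => h⟩
    | step x b _ ih =>
      intro t ht htZ htx
      by_cases hxZ : x ∈ Z
      · obtain ⟨p, hp, hpx⟩ := exists_period_of_mem_stuck hxZ
        have hpx' : ∀ q, (s.g ^ (p * q)) x = x := by
          intro q
          induction q with
          | zero => rfl
          | succ q ihq => rw [mul_add_one, pow_add, RelIso.mul_apply, hpx, ihq]
        obtain ⟨N₀, hN₀⟩ := exists_move hX hi₀ B t ht.mem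
        -- Since `x` has period `p`, adding `p * N₀` to the exponent makes it large enough without
        -- changing the image of `x`.
        obtain ⟨u, htu, hu⟩ := hN₀ (b + p * N₀)
          ((Nat.le_mul_of_pos_left _ hp).trans (Nat.le_add_left _ _))
        have hux : u.e k = f ((s.g ^ b) x) := by
          rw [hu.of_mem_stuck k (by rw [htZ, htx]; exact hxZ), htx,
            pow_apply_eq_of_agree ht.agree fun i _ => hxZ i, pow_add, RelIso.mul_apply, hpx']
        obtain ⟨v, hv, hvZ, hvk, hvj⟩ := ih u (ht.trans htu) (hu.stuck_eq.trans htZ) hux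
        refine ⟨v, hv, hvZ, hvk, fun j hj => hvj j ?_⟩
        have := hu.notMem_stuck j
        rw [htZ] at this
        exact this hj
      · exact ⟨t, ht, htZ, htx ▸ hxZ, fun _ h => h⟩
  have key : ∀ A : Finset K, ∃ t, Leads f X B s t ∧ stuck t.g t.F = Z ∧ ∀ k ∈ A, t.e k ∉ Z := by
    intro A
    induction A using Finset.induction_on with
    | empty => exact ⟨s, Leads.refl hs, rfl, by simp⟩
    | insert k A _ ih =>
      obtain ⟨t, ht, htZ, htA⟩ := ih
      obtain ⟨u, hu, huZ, huk, huj⟩ := hone k _ (hesc (t.e k)) t ht htZ rfl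
      refine ⟨u, hu, huZ, fun j hj => ?_⟩
      rcases Finset.mem_insert.1 hj with rfl | hj
      exacts [huk, huj j (htA j hj)]
  obtain ⟨t, ht, htZ, htA⟩ := key Finset.univ
  exact ⟨t, ht, fun j => by rw [htZ]; exact htA j (Finset.mem_univ j)⟩

end Configurations

/-! ### Joining two tuples and realizing a finite map -/

section Linking

variable {n : ℕ}

theorem exists_involution {ι : Type*} {C D : ι → Fin n × ℕ} (hC : Function.Injective C)
    (hD : Function.Injective D) (hCD : ∀ i j, C i ≠ D j) (hfst : ∀ i, (C i).1 = (D i).1) :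
    ∃ c : Aut (nKomega n), inducedPerm c = 1 ∧ c⁻¹ = c ∧ (∀ i, c (C i) = D i) ∧
      (∀ i, c (D i) = C i) ∧ ∀ x, (∀ i, C i ≠ x) → (∀ i, D i ≠ x) → c x = x := by
  classical
  let φ : Fin n × ℕ → Fin n × ℕ := fun x =>
    if h : ∃ i, C i = x then D h.choose else if h : ∃ i, D i = x then C h.choose else x
  have hφC : ∀ i, φ (C i) = D i := by
    intro i
    have h : ∃ j, C j = C i := ⟨i, rfl⟩
    simp only [φ, dif_pos h]
    rw [hC h.choose_spec]
  have hφD : ∀ i, φ (D i) = C i := by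
    intro i
    have h : ∃ j, D j = D i := ⟨i, rfl⟩
    have h' : ¬ ∃ j, C j = D i := fun ⟨j, hj⟩ => hCD j i hj
    simp only [φ, dif_neg h', dif_pos h]
    rw [hD h.choose_spec]
  have hφ : ∀ x, (∀ i, C i ≠ x) → (∀ i, D i ≠ x) → φ x = x := by
    intro x h1 h2
    simp only [φ, dif_neg (not_exists.2 h1), dif_neg (not_exists.2 h2)]
  have hcases : ∀ x, (∃ i, C i = x) ∨ (∃ i, D i = x) ∨ ((∀ i, C i ≠ x) ∧ ∀ i, D i ≠ x) := by
    intro x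
    by_cases h1 : ∃ i, C i = x
    · exact Or.inl h1
    by_cases h2 : ∃ i, D i = x
    · exact Or.inr (Or.inl h2)
    · exact Or.inr (Or.inr ⟨not_exists.1 h1, not_exists.1 h2⟩)
  have hinv : Function.Involutive φ := by
    intro x
    rcases hcases x with ⟨i, rfl⟩ | ⟨i, rfl⟩ | ⟨h1, h2⟩
    · rw [hφC, hφD]
    · rw [hφD, hφC]
    · rw [hφ x h1 h2, hφ x h1 h2]
  have hφfst : ∀ x, (φ x).1 = x.1 := by
    intro x
    rcases hcases x with ⟨i, rfl⟩ | ⟨i, rfl⟩ | ⟨h1, h2⟩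
    · rw [hφC, hfst]
    · rw [hφD, hfst]
    · rw [hφ x h1 h2]
  refine ⟨autOfPerm hinv.toPerm 1 hφfst, inducedPerm_autOfPerm _ _ _, ?_, hφC, hφD, hφ⟩
  rw [inv_eq_iff_mul_eq_one]
  exact RelIso.ext hinv

/-- Running the inverse from `e'` creates fresh chains that end in `e'` under `G⁻¹`. Conjugating
`G⁻¹` by an involution that exchanges them with the private chains ending in `e` joins the two while
fixing `S` pointwise. -/
theorem exists_link {K : Type*} [Finite K] {f : Aut (nKomega n)} {i₀ : Fin n}
    {S B : Finset (Fin n × ℕ)} {X : Set (Aut (nKomega n))} (hX : Flexible f S X)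
    (hi₀ : {x | x.1 = i₀ ∧ f x ≠ x}.Infinite) {g : Aut (nKomega n)} (hg : g ∈ X)
    {F : Finset (Fin n × ℕ)} {e e' : K → Fin n × ℕ} (he : Function.Injective e)
    (he' : Function.Injective e') (hSB : S ⊆ B) (he'B : ∀ k, e' k ∈ B)
    (he'F : ∀ k, ∀ z ∈ F, g z ≠ e' k) (hpriv : ∀ k, IsPrivate g F B e k)
    (hfst : ∀ k, (e' k).1 = inducedPerm g (e k).1) :
    ∃ g' ∈ X, (∀ x ∈ F, g' x = g x) ∧ ∀ k, g' (e k) = e' k := by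
  classical
  cases nonempty_fintype K
  choose c a hca hcF heF hc hcB hce using hpriv
  set T₀ := F ∪ (F.image g ∪ (B ∪ Finset.univ.image e)) with hT₀
  have hFT : F ⊆ T₀ := Finset.subset_union_left
  have hgFT : F.image g ⊆ T₀ := Finset.subset_union_left.trans Finset.subset_union_right
  have hBT : B ⊆ T₀ := Finset.subset_union_left.trans
    (Finset.subset_union_right.trans Finset.subset_union_right)
  have heT : ∀ j, e j ∈ T₀ := fun j => Finset.mem_union_right _ (Finset.mem_union_right _
    (Finset.mem_union_right _ (Finset.mem_image_of_mem _ (Finset.mem_univ j))))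
  set N := ∑ k, a k + 1 with hN
  have haN : ∀ k, a k + 1 ≤ N := fun k => Nat.succ_le_succ
    (Finset.single_le_sum (f := a) (fun _ _ => Nat.zero_le _) (Finset.mem_univ k))
  obtain ⟨G, F', T, h⟩ := exists_isRun (g₀ := g⁻¹) (F₀ := F.image g) hX hi₀ (hX.inv_mem g hg)
    (fun k => hBT (he'B k)) hgFT (fun x hx => by
      obtain ⟨y, hy, rfl⟩ := Finset.mem_image.1 hx
      rw [RelIso.inv_apply_self]
      exact hFT hy) N
  have hfresh : ∀ k m, m < N → (G ^ (m + 1)) (e' k) ∉ T₀ := by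
    intro k m hm
    rw [pow_succ', RelIso.mul_apply]
    refine (h.fresh _ (h.pow_mem k m hm) (h.pow_apply_notMem hgFT (fun hh => ?_) fun i hi =>
      h.pow_mem k i (hi.trans hm))).1
    obtain ⟨y, hy, hyk⟩ := Finset.mem_image.1 hh
    exact he'F k y hy hyk
  have hGg : ∀ x ∈ F, G⁻¹ x = g x := by
    intro x hx
    have := h.agree (g x) (Finset.mem_image_of_mem _ hx)
    rw [RelIso.inv_apply_self] at this
    conv_lhs => rw [← this]
    rw [RelIso.inv_apply_self]
  have hGperm : inducedPerm G⁻¹ = inducedPerm g := by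
    rw [inducedPerm_inv, h.perm, inducedPerm_inv, inv_inv]
  let ι := (k : K) × Fin (a k + 1)
  let C : ι → Fin n × ℕ := fun i => (g ^ (i.2 : ℕ)) (c i.1)
  -- Indexed so that `G⁻¹` runs up the chain; the last point is `G (e' k)`, one step before `e' k`,
  -- and takes the place of `e k`.
  let D : ι → Fin n × ℕ := fun i => (G ^ (a i.1 - i.2 + 1)) (e' i.1)
  have hDT : ∀ i, D i ∉ T₀ := fun i => hfresh _ _ (by have := haN i.1; omega)
  have hCB : ∀ i, C i ∉ B := fun i => hcB i.1 i.2 (by omega)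
  have hCT : ∀ i, C i ∈ T₀ := by
    rintro ⟨k, i, hi⟩
    rcases Nat.lt_succ_iff_lt_or_eq.1 hi with hi' | rfl
    · exact hFT (hcF k i hi')
    · have : C ⟨k, a k, hi⟩ = e k := (hca k).symm
      rw [this]
      exact heT k
  -- If two chains meet, the end that is reached first lies on the other chain, and by privacy it is
  -- that chain's end.
  have hCinj : Function.Injective C := by
    have key : ∀ k i k' i', i ≤ a k → i' ≤ a k' → (g ^ i) (c k) = (g ^ i') (c k') →
        a k - i ≤ a k' - i' → k = k' ∧ i = i' := by
      intro k i k' i' hi hi' heq hle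
      have h1 : e k = (g ^ (a k - i + i')) (c k') := by
        rw [pow_add, RelIso.mul_apply, ← heq, ← RelIso.mul_apply, ← pow_add, Nat.sub_add_cancel hi]
        exact hca k
      rcases Nat.lt_or_ge (a k - i + i') (a k') with hlt | hge
      · exact absurd h1.symm (hce k' _ hlt k)
      · rw [show a k - i + i' = a k' by omega, ← hca k'] at h1
        obtain rfl := he h1
        exact ⟨rfl, by omega⟩
    rintro ⟨k, i, hi⟩ ⟨k', i', hi'⟩ heq
    have : k = k' ∧ i = i' := by
      rcases le_total (a k - i) (a k' - i') with hle | hle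
      · exact key k i k' i' (by omega) (by omega) heq hle
      · exact (key k' i' k i (by omega) (by omega) heq.symm hle).imp Eq.symm Eq.symm
    obtain ⟨rfl, rfl⟩ := this
    rfl
  have hDinj : Function.Injective D := by
    have key : ∀ k m k' m', m' < N → (G ^ m) (e' k) = (G ^ m') (e' k') → m ≤ m' →
        k = k' ∧ m = m' := by
      intro k m k' m' hm' heq hle
      obtain ⟨d, rfl⟩ := Nat.exists_eq_add_of_le hle
      rw [pow_add, RelIso.mul_apply, (G ^ m).injective.eq_iff] at heq
      rcases d with _ | d
      · exact ⟨he' heq, rfl⟩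
      · exact absurd (heq ▸ hBT (he'B k)) (hfresh k' d (by omega))
    rintro ⟨k, i, hi⟩ ⟨k', i', hi'⟩ heq
    have heq' : (G ^ (a k - i)) (e' k) = (G ^ (a k' - i')) (e' k') := by
      apply G.injective
      rw [← RelIso.mul_apply, ← RelIso.mul_apply, ← pow_succ', ← pow_succ']
      exact heq
    have hk := haN k
    have hk' := haN k'
    have : k = k' ∧ a k - i = a k' - i' := by
      rcases le_total (a k - i) (a k' - i') with hle | hle
      · exact key _ _ _ _ (by omega) heq' hle
      · exact (key _ _ _ _ (by omega) heq'.symm hle).imp Eq.symm Eq.symm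
    obtain ⟨rfl, h2⟩ := this
    obtain rfl : i = i' := by omega
    rfl
  have hCD : ∀ i j, C i ≠ D j := fun i j hij => hDT j (hij ▸ hCT i)
  have hCDfst : ∀ i, (C i).1 = (D i).1 := by
    rintro ⟨k, i, hi⟩
    apply (inducedPerm g ^ (a k - i + 1)).injective
    have h1 : (inducedPerm g ^ (a k - i + 1)) (D ⟨k, i, hi⟩).1 = (e' k).1 := by
      rw [← hGperm, ← inducedPerm_pow, inducedPerm_fst, inv_pow]
      exact congrArg Prod.fst (RelIso.inv_apply_self (G ^ (a k - i + 1)) (e' k))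
    have h2 : (inducedPerm g ^ (a k - i + 1)) (C ⟨k, i, hi⟩).1 = (g ((g ^ a k) (c k))).1 := by
      rw [← inducedPerm_pow, inducedPerm_fst]
      change ((g ^ (a k - i + 1)) ((g ^ i) (c k))).1 = _
      rw [← RelIso.mul_apply, ← RelIso.mul_apply, ← pow_add, ← pow_succ',
        show a k - i + 1 + i = a k + 1 by omega]
    rw [h1, h2, ← hca, hfst, inducedPerm_fst]
  obtain ⟨s, hsperm, hsinv, hsC, hsD, hs⟩ := exists_involution hCinj hDinj hCD hCDfst
  refine ⟨s * G⁻¹ * s⁻¹, hX.conj_mem _ (hX.inv_mem _ h.mem) s hsperm fun x hx => ?_,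
    fun x hx => ?_, fun k => ?_⟩
  · exact hs x (fun i hi => hCB i (hi ▸ hSB hx)) fun i hi => hDT i (hi ▸ hBT (hSB hx))
  · rw [RelIso.mul_apply, RelIso.mul_apply, hsinv]
    by_cases hxC : ∃ i, C i = x
    · obtain ⟨⟨k, i, hi⟩, rfl⟩ := hxC
      have hia : i < a k := by
        refine lt_of_le_of_ne (Nat.lt_succ_iff.1 hi) ?_
        rintro rfl
        have : C ⟨k, a k, hi⟩ = e k := (hca k).symm
        exact heF k (this ▸ hx)
      have h1 : G⁻¹ (D ⟨k, i, hi⟩) = D ⟨k, i + 1, by omega⟩ := by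
        change G⁻¹ ((G ^ (a k - i + 1)) (e' k)) = (G ^ (a k - (i + 1) + 1)) (e' k)
        rw [pow_succ', RelIso.mul_apply, RelIso.inv_apply_self,
          show a k - (i + 1) + 1 = a k - i by omega]
      rw [hsC, h1, hsD]
      change (g ^ (i + 1)) (c k) = g ((g ^ i) (c k))
      rw [pow_succ', RelIso.mul_apply]
    -- Off the chains `x` is fixed, and so is `g x`: a chain's first point has no prescribed
    -- preimage, and any later one has its preimage on the chain.
    · have hxD : ∀ i, D i ≠ x := fun i hi => hDT i (hi ▸ hFT hx)
      rw [hs x (not_exists.1 hxC) hxD, hGg x hx]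
      refine hs _ ?_ fun i hi => hDT i (hi ▸ hgFT (Finset.mem_image_of_mem _ hx))
      rintro ⟨k, _ | i, hi⟩ heq
      · exact hc k x hx heq.symm
      · apply hxC
        refine ⟨⟨k, i, by omega⟩, g.injective ?_⟩
        rw [← heq]
        change g ((g ^ i) (c k)) = (g ^ (i + 1)) (c k)
        rw [pow_succ', RelIso.mul_apply]
  · have h1 : e k = C ⟨k, a k, by omega⟩ := hca k
    have h2 : G⁻¹ (D ⟨k, a k, by omega⟩) = e' k := by
      change G⁻¹ ((G ^ (a k - a k + 1)) (e' k)) = e' k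
      rw [Nat.sub_self, zero_add, pow_one, RelIso.inv_apply_self]
    rw [RelIso.mul_apply, RelIso.mul_apply, hsinv, h1, hsC, h2]
    exact hs _ (fun i hi => hCB i (hi ▸ he'B k)) fun i hi => hDT i (hi ▸ hBT (he'B k))

theorem NonStabilizing.exists_realization [NeZero n] {f : Aut (nKomega n)} (hf : NonStabilizing f)
    {S : Finset (Fin n × ℕ)} {X : Set (Aut (nKomega n))} (hX : Flexible f S X)
    {g : Aut (nKomega n)} (hg : g ∈ X) (u : Aut (nKomega n)) (F E : Finset (Fin n × ℕ)) :
    ∃ g' ∈ X, (∀ x ∈ F, g' x = g x) ∧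
      ∃ h ∈ Subgroup.closure {f, g'}, ∀ x ∈ E, h x = u x := by
  classical
  obtain ⟨i₀, hi₀⟩ := hf.exists_infinite_moved (hX.subset_genMates hg)
  -- The targets `u x` travel first, with the inverse of `g` as second generator.
  obtain ⟨t₁, h₁, hstuck₁⟩ := exists_leads_notMem_stuck hX hi₀ hf S
    (⟨g⁻¹, F.image g, fun x => u x⟩ : Config n E) (hX.inv_mem g hg)
  obtain ⟨t, h₂, -, hpriv⟩ := exists_leads_isPrivate hX hi₀ S t₁ h₁.mem hstuck₁
  have ht := h₁.trans h₂
  clear h₁ h₂ hstuck₁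
  -- Protecting the endpoints `t.e` during the second journey keeps them without prescribed
  -- preimages, as the link requires.
  set B := S ∪ Finset.univ.image t.e with hB
  have htB : ∀ k, t.e k ∈ B := fun k =>
    Finset.mem_union_right _ (Finset.mem_image_of_mem _ (Finset.mem_univ k))
  obtain ⟨v₁, k₁, hstuck₁⟩ := exists_leads_notMem_stuck hX hi₀ hf B
    (⟨t.g⁻¹, t.F.image t.g, fun x => x⟩ : Config n E) (hX.inv_mem _ ht.mem)
  obtain ⟨v₂, k₂, hstuck₂, hpriv₂⟩ := exists_leads_isPrivate hX hi₀ B v₁ k₁.mem hstuck₁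
  obtain ⟨p, hp⟩ := ht.exists_perm
  obtain ⟨q, hq⟩ := (k₁.trans k₂).exists_perm
  -- The permutation is chosen so that one application of `v.g` leads from the component of `v.e k`
  -- to that of `t.e k`.
  obtain ⟨v, k₃, -, hperm, hpriv₃⟩ := exists_leads_perm hX hi₀ B v₂ k₂.mem hstuck₂
    ((inducedPerm v₂.g)⁻¹ * p * inducedPerm u * q⁻¹)
  have hv := (k₁.trans k₂).trans k₃
  have hteF : ∀ k, ∀ z ∈ v.F, v.g z ≠ t.e k := by
    refine fun k => hv.protect _ (htB k) fun z hz => ?_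
    obtain ⟨w, hw, rfl⟩ := Finset.mem_image.1 hz
    obtain ⟨-, -, -, -, hkF, -⟩ := hpriv k
    dsimp only
    rw [RelIso.inv_apply_self]
    exact fun heq => hkF (heq ▸ hw)
  obtain ⟨g', hg', hagree, hlink⟩ := exists_link hX hi₀ hv.mem
    (hv.injective Subtype.val_injective)
    (ht.injective (u.injective.comp Subtype.val_injective)) Finset.subset_union_left htB hteF
    (fun k => hpriv₃ k (hpriv₂ k)) fun k => by
      rw [hperm, hq, hp, k₃.perm]
      simp [inducedPerm_fst]
  have hback : ∀ w ∈ t.F, g' (t.g w) = w := by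
    intro w hw
    have hw' : t.g w ∈ t.F.image t.g := Finset.mem_image_of_mem _ hw
    rw [hagree _ (hv.subset hw'), hv.agree _ hw']
    exact RelIso.inv_apply_self _ _
  refine ⟨g', hg', fun x hx => ?_, ?_⟩
  · have hgx : g x ∈ F.image g := Finset.mem_image_of_mem _ hx
    have h1 : t.g (g x) = x := by
      rw [ht.agree _ hgx]
      exact RelIso.inv_apply_self _ _
    have h2 := hback _ (ht.subset hgx)
    rwa [h1] at h2
  · obtain ⟨h₁, hh₁, h₁e⟩ := hv.carry g' hagree
    obtain ⟨h₂, hh₂, h₂e⟩ := ht.carry g'⁻¹ fun w hw => by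
      conv_lhs => rw [← hback w hw]
      rw [RelIso.inv_apply_self]
    have hg'mem : g' ∈ Subgroup.closure {f, g'} := Subgroup.subset_closure (by simp)
    have hle : Subgroup.closure {f, g'⁻¹} ≤ Subgroup.closure {f, g'} := by
      rw [Subgroup.closure_le]
      rintro _ (rfl | rfl)
      exacts [Subgroup.subset_closure (by simp), inv_mem hg'mem]
    -- `h₁` carries `x` to `v.e`, `g'` links this to `t.e`, and `h₂⁻¹` leads back from there to `u
    -- x`.
    refine ⟨h₂⁻¹ * g' * h₁, mul_mem (mul_mem (inv_mem (hle hh₂)) hg'mem) hh₁, fun x hx => ?_⟩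
    have e1 := h₁e ⟨x, hx⟩
    have e2 := h₂e ⟨x, hx⟩
    dsimp only at e1 e2
    rw [RelIso.mul_apply, RelIso.mul_apply, e1, hlink, ← e2, RelIso.inv_apply_self]

/-! ### The converse and the theorem -/

theorem exists_apply_eq (x y : Fin n × ℕ) : ∃ u : Aut (nKomega n), u x = y := by
  refine ⟨swapAut (y.1, x.2) y rfl * permuteComponents (Equiv.swap x.1 y.1), ?_⟩
  rw [RelIso.mul_apply, permuteComponents_apply, Equiv.swap_apply_left, swapAut_apply,
    Equiv.swap_apply_left]

/-- `𝓐_f` is open in a Baire space, hence Baire, so `D_f` is dense in it and meets the basic set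
given by `q`; by vertex transitivity a dense subgroup moves `x` to a vertex outside `Γ`. -/
theorem nonStabilizing_of_isComeagreIn {f : Aut (nKomega n)}
    (h : IsComeagreIn (denseMates f) (genMates f)) : NonStabilizing f := by
  rintro Γ hΓ x hx q ⟨g, hgq, hg⟩
  obtain ⟨y, -, hy⟩ := Set.exists_of_ssubset hΓ
  have : BaireSpace (Aut (nKomega n)) := baireSpace_aut
  have : BaireSpace (genMates f) := (isOpen_genMates f).baireSpace
  have hq : IsOpen (Subtype.val ⁻¹' q.extensions : Set (genMates f)) :=
    (TopologicalSpace.isOpen_generateFrom_of_mem ⟨q, rfl⟩ : IsOpen q.extensions).preimage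
      continuous_subtype_val
  obtain ⟨⟨g', hg'⟩, hg'q, hg'D⟩ := (dense_of_mem_residual h.2).inter_open_nonempty _ hq
    ⟨⟨g, hg⟩, hgq⟩
  obtain ⟨u, rfl⟩ := exists_apply_eq x y
  obtain ⟨k, hk, hkx⟩ := dense_iff_agree.1 hg'D u {x}
  exact ⟨g', ⟨hg'q, hg'⟩, k, hk, by rwa [hkx x (Finset.mem_singleton_self x)]⟩

end Linking

end GraphAut

theorem mainTheorem2 (n : ℕ) (hn : 2 ≤ n) (f : GraphAut.Aut (GraphAut.nKomega n)) :
    (GraphAut.NonStabilizing f ↔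
      GraphAut.IsComeagreIn (GraphAut.denseMates f) (GraphAut.genMates f)) ∧
    (GraphAut.NonStabilizing f →
      ∀ S : Finset (Fin n × ℕ),
        GraphAut.IsComeagreIn
          (GraphAut.denseMates f ∩ GraphAut.genMatesWithReps f (S : Set (Fin n × ℕ)))
          (GraphAut.genMatesWithReps f (S : Set (Fin n × ℕ)))) := by
  have : NeZero n := ⟨by omega⟩
  refine ⟨⟨fun hf => ⟨GraphAut.denseMates_subset_genMates f, ?_⟩,
    GraphAut.nonStabilizing_of_isComeagreIn⟩, fun hf S => ⟨Set.inter_subset_right, ?_⟩⟩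
  · exact GraphAut.denseMates_mem_residual f _ fun g hg u F E =>
      hf.exists_realization (GraphAut.flexible_genMates f) hg u F E
  · rw [Set.preimage_inter, Subtype.coe_preimage_self, Set.inter_univ]
    exact GraphAut.denseMates_mem_residual f _ fun g hg u F E =>
      hf.exists_realization (GraphAut.flexible_genMatesWithReps f S) hg u F E
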